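/- Let $p(z)=a_0\prod_{k=1}^{d}(z-\lambda_k)^{n_k}$ be a real polynomial with only real zeroes, where $a_0\in\mathbb{R}\setminus\{0\}$, $\lambda_1<\lambda_2<\dots<\lambda_d$ are real, $n_k\ge 1$ are integers, and $n=n_1+\dots+n_d=\deg p$. For $\varkappa\in\mathbb{R}$ put $$F_\varkappa[p](z)=p(z)p''(z)-\varkappa\,[p'(z)]^2,$$ and let $Z_C(f)$ denote the number of non-real zeroes of a real polynomial $f$, counted with multiplicities. **Theorem 2.2.** Let $d\ge 3$ and suppose that the zeroes $\lambda_2,\dots,\lambda_{d-1}$ all have the same multiplicity $m$, i.e. $n_2=\dots=n_{d-1}=m$. Let $\varkappa\in\mathbb{R}$. If $\varkappa\le\frac{m-1}{m}$, then $Z_C(F_\varkappa[p])=0$. If $\varkappa>\frac{m-1}{m}$, then the following hold: * if $\frac{m-1}{m}<\varkappa<\frac{n-d+1}{n-d+2}$, then $0\le Z_C(F_\varkappa[p])\le 2d-4$; * if $\frac{n-d+k-1}{n-d+k}\le\varkappa<\frac{n-d+k}{n-d+k+1}$ for some integer $k$ with $2\le k\le d-1$, then $2k-2\le Z_C(F_\varkappa[p])\le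 2d-4$; * if $\varkappa=\frac{n-1}{n}$, then $Z_C(F_\varkappa[p])=2d-4$; * if $\varkappa>\frac{n-1}{n}$, then $Z_C(F_\varkappa[p])=2d-2$. -/

import Mathlib

open Polynomial

/-- The differential polynomial `F_κ[p] = p p'' - κ (p')²` of a real polynomial `p`. -/
noncomputable def diffPoly (κ : ℝ) (p : ℝ[X]) : ℝ[X] :=
  p * derivative (derivative p) - C κ * (derivative p) ^ 2

open scoped Classical in
/-- `Z_C(f)`: the number of non-real (complex) zeroes of the real polynomial `f`,
counted with multiplicities. -/
noncomputable def numNonrealZeros (f : ℝ[X]) : ℕ :=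
  Multiset.card ((f.map (algebraMap ℝ ℂ)).roots.filter (fun z : ℂ => z.im ≠ 0))

/-- The polynomial `a₀ ∏ₖ (z - λₖ) ^ nₖ` with prescribed real zeroes `λₖ` and exponents `nₖ`. -/
noncomputable def realRootedPoly {d : ℕ} (a₀ : ℝ) (lam : Fin d → ℝ) (mult : Fin d → ℕ) : ℝ[X] :=
  C a₀ * ∏ k, (X - C (lam k)) ^ mult k

/-! Put `L = p'/p` and `a = 1 - κ`, so that `F_κ[p] = p² (a L² + L')`. The zeros `μ i` of `L`
interlace with the `d` poles, and `1/L` has the form `(X + s - ∑ β i / (X - μ i)) / n`.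
Differentiating gives `a L² + L' = -(L²/n) (∑ β i / (X - μ i)² - c)` with `c = a n - 1`, and
evaluation at `μ i` shows `β i > 0` (`exists_doublePoleNumerator`). Up to real zeros and a constant,
everything is thus about the numerator of `∑ β i / (X - μ i)² - c`, of degree `2d - 2` if `c ≠ 0`
and `2d - 4` if `c = 0`.

For `c ≤ 0` this function is positive, so all zeros are non-real. For `c > 0` it is monotone on the
two outer gaps between the `μ i`, which hold one zero each, and convex on the `d - 2` inner gaps,
which hold none or two. So only the inner gaps meeting `a L² + L' ≥ 0` have to be counted. At an
inner zero `λ` of `p`, of multiplicity `m`, the numerator of this expression has the sign of `a m -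
1`; if `κ ≤ (m - 1)/m`, every inner gap therefore has two real zeros.

The lower bounds come from `card_gaps_lt`: when `a ≤ 1/(n - s)`, fewer than `s` inner gaps qualify.
A point with `a L² + L' ≥ 0` gives a reversed Cauchy–Schwarz inequality for the numbers `1/(x - λ
k)`. By it, deleting poles of total weight at most `n - s` cannot change the sign of `L(x)`
(`sum_compl_neg`). Deleting a block of consecutive poles then bounds how far from the ends a
qualifying gap can be, and `card_lt_of_left_or_right` turns this into a count. -/

/-! ### Non-real zeros as degree minus real zeros. -/

theorem numNonrealZeros_mul {f g : ℝ[X]} (hf : f ≠ 0) (hg : g ≠ 0) :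
    numNonrealZeros (f * g) = numNonrealZeros f + numNonrealZeros g := by
  have h : (f.map (algebraMap ℝ ℂ)) * (g.map (algebraMap ℝ ℂ)) ≠ 0 :=
    mul_ne_zero ((Polynomial.map_ne_zero_iff (algebraMap ℝ ℂ).injective).2 hf)
      ((Polynomial.map_ne_zero_iff (algebraMap ℝ ℂ).injective).2 hg)
  simp [numNonrealZeros, Polynomial.map_mul, roots_mul h]

theorem numNonrealZeros_eq_zero_of_splits {f : ℝ[X]} (hf : f.Splits) :
    numNonrealZeros f = 0 := by
  rw [numNonrealZeros, hf.roots_map, Multiset.card_eq_zero, Multiset.filter_eq_nil]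
  intro z hz
  obtain ⟨x, -, rfl⟩ := Multiset.mem_map.1 hz
  simp

theorem numNonrealZeros_of_roots_eq_zero {f : ℝ[X]} (hf : f ≠ 0) (hr : f.roots = 0) :
    numNonrealZeros f = f.natDegree := by
  have h : ∀ z ∈ (f.map (algebraMap ℝ ℂ)).roots, z.im ≠ 0 := by
    intro z hz him
    have hz' : z = algebraMap ℝ ℂ z.re := by
      apply Complex.ext <;> simp [him]
    have : z.re ∈ f.roots := by
      rw [mem_roots hf, IsRoot]
      have h1 := (mem_roots'.1 hz).2
      rw [hz', IsRoot, eval_map_algebraMap, aeval_algebraMap_apply] at h1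
      simpa using h1
    simp [hr] at this
  rw [numNonrealZeros, Multiset.filter_eq_self.2 h, ← natDegree_map (algebraMap ℝ ℂ)]
  exact (splits_iff_card_roots.1 (IsAlgClosed.splits _))

theorem numNonrealZeros_add_card_roots {f : ℝ[X]} (hf : f ≠ 0) :
    numNonrealZeros f + f.roots.card = f.natDegree := by
  obtain ⟨g, hfg, hdeg, hg⟩ := exists_prod_multiset_X_sub_C_mul f
  have h0 : (f.roots.map fun a => X - C a).prod * g ≠ 0 := by rwa [hfg]
  have h1 := numNonrealZeros_mul (left_ne_zero_of_mul h0) (right_ne_zero_of_mul h0)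
  rw [hfg, numNonrealZeros_of_roots_eq_zero (right_ne_zero_of_mul h0) hg,
    numNonrealZeros_eq_zero_of_splits
      (Splits.multisetProd (by simp only [Multiset.mem_map]; rintro _ ⟨a, -, rfl⟩; exact Splits.X_sub_C a))] at h1
  omega

/-! ### Sums of double poles: sign, degree, convexity and monotonicity. -/

/-- The numerator of `∑ i, β i / (X - μ i) ^ 2 - c` over the common denominator
`∏ i, (X - μ i) ^ 2`. -/
noncomputable def doublePoleNumerator {ι : Type*} [Fintype ι] [DecidableEq ι] (β μ : ι → ℝ)
    (c : ℝ) : ℝ[X] :=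
  ∑ i, C (β i) * Lagrange.nodal (Finset.univ.erase i) μ ^ 2 -
    C c * Lagrange.nodal Finset.univ μ ^ 2

namespace doublePoleNumerator

section General

variable {ι : Type*} [Fintype ι] [DecidableEq ι] {β μ : ι → ℝ} {c : ℝ}

theorem eval_eq (x : ℝ) : (doublePoleNumerator β μ c).eval x =
    ∑ i, β i * (Lagrange.nodal (Finset.univ.erase i) μ).eval x ^ 2 -
      c * (Lagrange.nodal Finset.univ μ).eval x ^ 2 := by
  simp [doublePoleNumerator, eval_finsetSum]

/-- The point `x` coincides with at most one node; the term omitting that node does not vanish. -/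
theorem sum_pos (hβ : ∀ i, 0 < β i) (hμ : Function.Injective μ) [Nonempty ι] (x : ℝ) :
    0 < ∑ i, β i * (Lagrange.nodal (Finset.univ.erase i) μ).eval x ^ 2 := by
  have key : ∃ i, ∀ j ∈ Finset.univ.erase i, x ≠ μ j := by
    by_cases h : ∃ i, x = μ i
    · obtain ⟨i, hi⟩ := h
      refine ⟨i, fun j hj hx => Finset.ne_of_mem_erase hj (hμ (hx.symm.trans hi))⟩
    · push Not at h
      exact ⟨Classical.arbitrary ι, fun j _ => h j⟩
  obtain ⟨i, hi⟩ := key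
  refine Finset.sum_pos' (fun j _ => mul_nonneg (hβ j).le (sq_nonneg _)) ⟨i, Finset.mem_univ _, ?_⟩
  have := Lagrange.eval_nodal_not_at_node hi
  have := hβ i
  positivity

theorem eval_pos_of_nonpos (hβ : ∀ i, 0 < β i) (hμ : Function.Injective μ) [Nonempty ι]
    (hc : c ≤ 0) (x : ℝ) : 0 < (doublePoleNumerator β μ c).eval x := by
  have h1 := sum_pos hβ hμ x
  have h2 := mul_nonneg (neg_nonneg.2 hc)
    (sq_nonneg ((Lagrange.nodal Finset.univ μ).eval x))
  rw [eval_eq]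
  linarith

theorem eval_pole_pos (hβ : ∀ i, 0 < β i) (hμ : Function.Injective μ) (i : ι) :
    0 < (doublePoleNumerator β μ c).eval (μ i) := by
  have : Nonempty ι := ⟨i⟩
  have h1 := sum_pos hβ hμ (μ i)
  rw [eval_eq, Lagrange.eval_nodal_at_node (Finset.mem_univ i)]
  simpa using h1

theorem ne_zero (hβ : ∀ i, 0 < β i) (hμ : Function.Injective μ) [Nonempty ι] :
    doublePoleNumerator β μ c ≠ 0 := by
  intro h
  have := eval_pole_pos (c := c) hβ hμ (Classical.arbitrary ι)
  simp [h] at this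

theorem natDegree_sum_le : (∑ i, C (β i) * Lagrange.nodal (Finset.univ.erase i) μ ^ 2).natDegree ≤
    2 * (Fintype.card ι - 1) := by
  refine natDegree_sum_le_of_forall_le _ _ fun i _ => ?_
  refine (natDegree_C_mul_le _ _).trans ?_
  rw [Lagrange.nodal_monic.natDegree_pow, Lagrange.natDegree_nodal,
    Finset.card_erase_of_mem (Finset.mem_univ i), Finset.card_univ]

theorem natDegree_eq_of_ne_zero [Nonempty ι] (hc : c ≠ 0) :
    (doublePoleNumerator β μ c).natDegree = 2 * Fintype.card ι := by
  have h1 : (C c * Lagrange.nodal Finset.univ μ ^ 2).natDegree = 2 * Fintype.card ι := by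
    rw [natDegree_C_mul hc, Lagrange.nodal_monic.natDegree_pow, Lagrange.natDegree_nodal,
      Finset.card_univ]
  have h2 := natDegree_sum_le (β := β) (μ := μ)
  have h3 : 0 < Fintype.card ι := Fintype.card_pos
  rw [doublePoleNumerator, natDegree_sub_eq_right_of_natDegree_lt (by omega), h1]

theorem natDegree_eq_of_eq_zero (hβ : ∀ i, 0 < β i) [Nonempty ι] :
    (doublePoleNumerator β μ 0).natDegree = 2 * (Fintype.card ι - 1) := by
  have h2 := natDegree_sum_le (β := β) (μ := μ)
  have h : doublePoleNumerator β μ 0 =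
      ∑ i, C (β i) * Lagrange.nodal (Finset.univ.erase i) μ ^ 2 := by
    simp [doublePoleNumerator]
  rw [h]
  refine natDegree_eq_of_le_of_coeff_ne_zero h2 ?_
  have h3 : ∀ i, (C (β i) * Lagrange.nodal (Finset.univ.erase i) μ ^ 2).coeff
      (2 * (Fintype.card ι - 1)) = β i := by
    intro i
    have h4 : (Lagrange.nodal (Finset.univ.erase i) μ ^ 2).natDegree =
        2 * (Fintype.card ι - 1) := by
      rw [Lagrange.nodal_monic.natDegree_pow, Lagrange.natDegree_nodal,
        Finset.card_erase_of_mem (Finset.mem_univ i), Finset.card_univ]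
    rw [coeff_C_mul, ← h4, (Lagrange.nodal_monic.pow 2).coeff_natDegree, mul_one]
  rw [finsetSum_coeff, Finset.sum_congr rfl fun i _ => h3 i]
  exact (Finset.sum_pos (fun i _ => hβ i) Finset.univ_nonempty).ne'

theorem numNonrealZeros_of_nonpos (hβ : ∀ i, 0 < β i) (hμ : Function.Injective μ) [Nonempty ι]
    (hc : c ≤ 0) : numNonrealZeros (doublePoleNumerator β μ c) =
      (doublePoleNumerator β μ c).natDegree := by
  refine numNonrealZeros_of_roots_eq_zero (ne_zero hβ hμ) ?_
  refine Multiset.eq_zero_of_forall_notMem fun x hx => ?_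
  exact (eval_pos_of_nonpos hβ hμ hc x).ne' (mem_roots'.1 hx).2

/-- Far away from all poles the numerator is nonpositive. -/
theorem eval_nonpos_of_far (hβ : ∀ i, 0 < β i) {x t : ℝ} (ht : 0 < t)
    (hx : ∀ i, t ≤ |x - μ i|) (hB : ∑ i, β i ≤ c * t ^ 2) :
    (doublePoleNumerator β μ c).eval x ≤ 0 := by
  have h1 : ∀ i, t ^ 2 * (Lagrange.nodal (Finset.univ.erase i) μ).eval x ^ 2 ≤
      (Lagrange.nodal Finset.univ μ).eval x ^ 2 := by
    intro i
    rw [Lagrange.nodal_eq_mul_nodal_erase (Finset.mem_univ i), eval_mul, mul_pow]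
    refine mul_le_mul_of_nonneg_right ?_ (sq_nonneg _)
    rw [← sq_abs (eval x _)]
    simpa using pow_le_pow_left₀ ht.le (hx i) 2
  have h2 : t ^ 2 * ∑ i, β i * (Lagrange.nodal (Finset.univ.erase i) μ).eval x ^ 2 ≤
      (∑ i, β i) * (Lagrange.nodal Finset.univ μ).eval x ^ 2 := by
    rw [Finset.mul_sum, Finset.sum_mul]
    refine Finset.sum_le_sum fun i _ => ?_
    have := mul_le_mul_of_nonneg_left (h1 i) (hβ i).le
    linarith
  have h3 := mul_le_mul_of_nonneg_right hB (sq_nonneg ((Lagrange.nodal Finset.univ μ).eval x))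
  rw [eval_eq]
  have ht2 : 0 < t ^ 2 := by positivity
  by_contra hcon
  push Not at hcon
  have := mul_pos ht2 hcon
  nlinarith

/-- If `r i` inverts `(X - μ i) ^ 2` modulo `W` and the leading terms of the `r i` do not cancel
out, then `W` does not divide the numerator. -/
theorem not_dvd_of_inverses {W : ℝ[X]} {N : ℕ} (hN : 1 ≤ N) (hW : N < W.natDegree)
    (r : ι → ℝ[X]) (hr : ∀ i, W ∣ (X - C (μ i)) ^ 2 * r i - 1) (hdeg : ∀ i, (r i).natDegree ≤ N)
    (hlead : ∑ i, β i * (r i).coeff N ≠ 0) : ¬ W ∣ doublePoleNumerator β μ c := by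
  intro hdvd
  set Q := Lagrange.nodal Finset.univ μ with hQ
  have h1 : W ∣ doublePoleNumerator β μ c - Q ^ 2 * (∑ i, C (β i) * r i - C c) := by
    have : doublePoleNumerator β μ c - Q ^ 2 * (∑ i, C (β i) * r i - C c) =
        ∑ i, C (β i) * Lagrange.nodal (Finset.univ.erase i) μ ^ 2 *
          (-((X - C (μ i)) ^ 2 * r i - 1)) := by
      have h2 : ∀ i, C (β i) * Lagrange.nodal (Finset.univ.erase i) μ ^ 2 *
          (-((X - C (μ i)) ^ 2 * r i - 1)) =
          C (β i) * Lagrange.nodal (Finset.univ.erase i) μ ^ 2 - Q ^ 2 * (C (β i) * r i) := by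
        intro i
        rw [hQ, Lagrange.nodal_eq_mul_nodal_erase (Finset.mem_univ i)]
        ring
      rw [Finset.sum_congr rfl fun i _ => h2 i, Finset.sum_sub_distrib, ← Finset.mul_sum,
        doublePoleNumerator]
      ring
    rw [this]
    exact Finset.dvd_sum fun i _ => Dvd.dvd.mul_left ((hr i).neg_right) _
  have h2 : W ∣ Q ^ 2 * (∑ i, C (β i) * r i - C c) := (dvd_sub_right hdvd).1 h1
  -- Each `X - C (μ i)` is a unit modulo `W`, hence so is their product `Q`.
  have h3 : IsCoprime W (Q ^ 2) := by
    refine IsCoprime.pow_right ?_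
    rw [hQ, Lagrange.nodal]
    refine IsCoprime.prod_right fun i _ => ?_
    obtain ⟨s, hs⟩ := hr i
    exact ⟨-s, (X - C (μ i)) * r i, by linear_combination hs⟩
  have h4 := h3.dvd_of_dvd_mul_left h2
  have h5 : (∑ i, C (β i) * r i - C c).coeff N ≠ 0 := by
    rw [coeff_sub, finsetSum_coeff, coeff_C_of_ne_zero (by omega), sub_zero]
    simpa [coeff_C_mul] using hlead
  have h6 : (∑ i, C (β i) * r i - C c).natDegree ≤ N := by
    refine (natDegree_sub_le _ _).trans (max_le ?_ (by simp))
    exact natDegree_sum_le_of_forall_le _ _ fun i _ => (natDegree_C_mul_le _ _).trans (hdeg i)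
  have h7 := natDegree_le_of_dvd h4 (fun h => h5 (by rw [h, coeff_zero]))
  omega

theorem coeff_quadratic (a b c t : ℝ) :
    (C a * (X - C t) ^ 2 + C b * (X - C t) + C c).coeff 2 = a := by
  have : C a * (X - C t) ^ 2 + C b * (X - C t) + C c =
      C a * X ^ 2 + C (b - 2 * a * t) * X + C (a * t ^ 2 - b * t + c) := by
    simp only [map_sub, map_add, map_mul, map_pow, C_ofNat]
    ring
  rw [this]
  generalize b - 2 * a * t = u
  generalize a * t ^ 2 - b * t + c = v
  simp

theorem coeff_linear (a b t : ℝ) : (C a * (X - C t) + C b).coeff 1 = a := by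
  simp [mul_sub]

/-- Algebraic form of strict convexity away from the poles: the second divided difference of `1/(t -
μ i)²` at points on one side of `μ i` is positive. Stated as non-divisibility, it covers coinciding
points, hence multiple roots. -/
theorem not_dvd_three [Nonempty ι] (hβ : ∀ i, 0 < β i) {x y z : ℝ}
    (hxy : ∀ i, 0 < (x - μ i) * (y - μ i)) (hyz : ∀ i, 0 < (y - μ i) * (z - μ i)) :
    ¬ (X - C x) * ((X - C y) * (X - C z)) ∣ doublePoleNumerator β μ c := by
  have hxz : ∀ i, 0 < (x - μ i) * (z - μ i) := fun i => by
    have h1 := mul_pos (hxy i) (hyz i)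
    have h2 : 0 < (y - μ i) ^ 2 := by
      have : y - μ i ≠ 0 := fun h => by simpa [h] using hxy i
      positivity
    nlinarith
  set e₁ : ι → ℝ := fun i => (x - μ i) + (y - μ i) + (z - μ i)
  set e₂ : ι → ℝ := fun i =>
    (x - μ i) * (y - μ i) + (y - μ i) * (z - μ i) + (x - μ i) * (z - μ i)
  set e₃ : ι → ℝ := fun i => (x - μ i) * (y - μ i) * (z - μ i)
  have he₃ : ∀ i, e₃ i ≠ 0 := fun i h => by
    rcases mul_eq_zero.1 h with h | h
    · exact (hxy i).ne' h
    · simpa [h] using hyz i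
  have he₂ : ∀ i, 0 < e₂ i := fun i => add_pos (add_pos (hxy i) (hyz i)) (hxz i)
  -- `α i` is the divided difference of `1/(t - μ i)²` at `x, y, z`, and `r i` is the interpolating
  -- quadratic, obtained by inverting `(X - μ i)²` modulo the cubic.
  set α : ι → ℝ := fun i => e₂ i / e₃ i ^ 2
  have hα : ∀ i, 0 < α i := fun i => div_pos (he₂ i) (by have := he₃ i; positivity)
  set r : ι → ℝ[X] := fun i => C (α i) * (X - C (μ i)) ^ 2 +
    C (1 / e₃ i - α i * e₁ i) * (X - C (μ i)) + C (α i * e₂ i - 1 / e₃ i * e₁ i)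
  refine not_dvd_of_inverses (N := 2) (by norm_num) ?_ r ?_ ?_ ?_
  · rw [((monic_X_sub_C x).natDegree_mul ((monic_X_sub_C y).mul (monic_X_sub_C z))),
      (monic_X_sub_C y).natDegree_mul (monic_X_sub_C z)]
    simp
  · intro i
    refine ⟨C (α i) * (X - C (μ i)) + C (1 / e₃ i), ?_⟩
    have h1 : (X - C x) * ((X - C y) * (X - C z)) = (X - C (μ i)) ^ 3 -
        C (e₁ i) * (X - C (μ i)) ^ 2 + C (e₂ i) * (X - C (μ i)) - C (e₃ i) := by
      simp only [e₁, e₂, e₃, map_add, map_sub, map_mul]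
      ring
    have h2 : C (1 / e₃ i) * C (e₃ i) = (1 : ℝ[X]) := by
      rw [← C_mul, one_div_mul_cancel (he₃ i), C_1]
    have h3 : C (α i) * C (e₃ i) = C (1 / e₃ i) * C (e₂ i) := by
      rw [← C_mul, ← C_mul]
      congr 1
      have := he₃ i
      simp only [α]
      field_simp
    rw [h1]
    simp only [r, map_sub, map_mul]
    linear_combination (X - C (μ i)) * h3 + h2
  · intro i
    simp only [r]
    compute_degree
  · have : ∀ i, (r i).coeff 2 = α i := fun i => coeff_quadratic _ _ _ _
    rw [Finset.sum_congr rfl fun i _ => by rw [this i]]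
    exact (Finset.sum_pos (fun i _ => mul_pos (hβ i) (hα i)) Finset.univ_nonempty).ne'

/-- Strict monotonicity beyond all poles, through first divided differences `α i`. The sign of `s`
tells on which side of the poles `x` and `y` lie, and all `α i` have the opposite sign. -/
theorem not_dvd_two [Nonempty ι] (hβ : ∀ i, 0 < β i) {x y s : ℝ} (hs : s ≠ 0)
    (hx : ∀ i, 0 < s * (x - μ i)) (hy : ∀ i, 0 < s * (y - μ i)) :
    ¬ (X - C x) * (X - C y) ∣ doublePoleNumerator β μ c := by
  set e₁ : ι → ℝ := fun i => (x - μ i) + (y - μ i)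
  set e₂ : ι → ℝ := fun i => (x - μ i) * (y - μ i)
  have he₂ : ∀ i, 0 < e₂ i := fun i => by
    have h1 := mul_pos (hx i) (hy i)
    have h2 : 0 < s ^ 2 := by positivity
    simp only [e₂]
    by_contra h
    push Not at h
    nlinarith
  have he₁ : ∀ i, 0 < s * e₁ i := fun i => by
    have := add_pos (hx i) (hy i)
    simp only [e₁]
    linarith
  set α : ι → ℝ := fun i => -(e₁ i / e₂ i ^ 2)
  set r : ι → ℝ[X] := fun i => C (α i) * (X - C (μ i)) + C (-(1 / e₂ i) - α i * e₁ i)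
  refine not_dvd_of_inverses (N := 1) (by norm_num) ?_ r ?_ ?_ ?_
  · rw [(monic_X_sub_C x).natDegree_mul (monic_X_sub_C y)]
    simp
  · intro i
    refine ⟨C (α i) * (X - C (μ i)) - C (1 / e₂ i), ?_⟩
    have h1 : (X - C x) * (X - C y) = (X - C (μ i)) ^ 2 -
        C (e₁ i) * (X - C (μ i)) + C (e₂ i) := by
      simp only [e₁, e₂, map_add, map_sub, map_mul]
      ring
    have h2 : C (1 / e₂ i) * C (e₂ i) = (1 : ℝ[X]) := by
      rw [← C_mul, one_div_mul_cancel (he₂ i).ne', C_1]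
    have h3 : C (α i) * C (e₂ i) = - (C (1 / e₂ i) * C (e₁ i)) := by
      rw [← C_mul, ← C_mul, ← C_neg]
      congr 1
      have := (he₂ i).ne'
      simp only [α]
      field_simp
    rw [h1]
    simp only [r, map_sub, map_mul, map_neg]
    linear_combination - (X - C (μ i)) * h3 + h2
  · intro i
    simp only [r]
    compute_degree
  · have : ∀ i, (r i).coeff 1 = α i := fun i => coeff_linear _ _ _
    rw [Finset.sum_congr rfl fun i _ => by rw [this i]]
    intro h
    have h1 : 0 < ∑ i, -(s * (β i * α i)) := by
      refine Finset.sum_pos (fun i _ => ?_) Finset.univ_nonempty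
      have : -(s * (β i * α i)) = β i * (s * e₁ i / e₂ i ^ 2) := by
        simp only [α]; ring
      rw [this]
      have := hβ i
      have := he₁ i
      have := he₂ i
      positivity
    rw [Finset.sum_neg_distrib, ← Finset.mul_sum, h] at h1
    simp at h1

end General

end doublePoleNumerator

/-! ### Counting real roots in a set, with multiplicities. -/

section RootsInIntervals

open scoped Classical in
/-- The number of roots of `f` in `S`, with multiplicities. -/
noncomputable def rootCountIn (f : ℝ[X]) (S : Set ℝ) : ℕ :=
  Multiset.card (f.roots.filter (· ∈ S))

variable {f : ℝ[X]} {S : Set ℝ}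

theorem rootCountIn_eq_card_filter [DecidablePred (· ∈ S)] :
    rootCountIn f S = Multiset.card (f.roots.filter (· ∈ S)) := by
  unfold rootCountIn
  congr!

theorem one_le_rootCountIn (hf : f ≠ 0) {x : ℝ} (hx : f.eval x = 0) (hxS : x ∈ S) :
    1 ≤ rootCountIn f S := by
  classical
  rw [rootCountIn_eq_card_filter]
  exact Multiset.card_pos_iff_exists_mem.2
    ⟨x, Multiset.mem_filter.2 ⟨(mem_roots hf).2 hx, hxS⟩⟩

theorem two_le_rootCountIn_of_ne (hf : f ≠ 0) {x y : ℝ} (hxy : x ≠ y) (hx : f.eval x = 0)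
    (hy : f.eval y = 0) (hxS : x ∈ S) (hyS : y ∈ S) : 2 ≤ rootCountIn f S := by
  classical
  have h : ({x, y} : Multiset ℝ) ≤ f.roots.filter (· ∈ S) := by
    rw [Multiset.le_iff_subset (by simpa using hxy)]
    intro t ht
    rcases by simpa using ht with rfl | rfl
    · exact Multiset.mem_filter.2 ⟨(mem_roots hf).2 hx, hxS⟩
    · exact Multiset.mem_filter.2 ⟨(mem_roots hf).2 hy, hyS⟩
  have := Multiset.card_le_card h
  rw [Multiset.card_pair] at this
  rwa [rootCountIn_eq_card_filter]

theorem two_le_rootCountIn_of_derivative (hf : f ≠ 0) {x : ℝ} (hx : f.eval x = 0)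
    (hx' : (derivative f).eval x = 0) (hxS : x ∈ S) : 2 ≤ rootCountIn f S := by
  classical
  have h1 : 1 < f.rootMultiplicity x :=
    (one_lt_rootMultiplicity_iff_isRoot hf).2 ⟨hx, hx'⟩
  have h : Multiset.replicate 2 x ≤ f.roots.filter (· ∈ S) := by
    rw [← Multiset.le_count_iff_replicate_le, Multiset.count_filter_of_pos hxS, count_roots]
    exact h1
  have := Multiset.card_le_card h
  rw [Multiset.card_replicate] at this
  rwa [rootCountIn_eq_card_filter]

theorem rootCountIn_eq_zero (h : ∀ x ∈ S, f.eval x ≠ 0) : rootCountIn f S = 0 := by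
  classical
  refine Multiset.card_eq_zero.2 (Multiset.filter_eq_nil.2 fun x hx hxS => ?_)
  exact h x hxS (mem_roots'.1 hx).2

theorem Multiset.exists_le_card_eq_of_le_card {α : Type*} {s : Multiset α} {n : ℕ}
    (h : n ≤ s.card) : ∃ t ≤ s, t.card = n := by
  have h1 : 0 < (s.powersetCard n).card := by
    rw [Multiset.card_powersetCard]
    exact Nat.choose_pos h
  obtain ⟨t, ht⟩ := Multiset.card_pos_iff_exists_mem.1 h1
  exact ⟨t, Multiset.mem_powersetCard.1 ht⟩

/-- The case `x = y` is included in the hypothesis, so it also excludes double roots. -/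
theorem rootCountIn_le_one
    (h : ∀ x ∈ S, ∀ y ∈ S, ¬ (X - C x) * (X - C y) ∣ f) : rootCountIn f S ≤ 1 := by
  classical
  by_contra hcon
  push Not at hcon
  obtain ⟨t, ht, hc⟩ := Multiset.exists_le_card_eq_of_le_card (n := 2) (s := f.roots.filter (· ∈ S))
    (by rwa [← rootCountIn_eq_card_filter])
  obtain ⟨x, y, rfl⟩ := Multiset.card_eq_two.1 hc
  have hS : ∀ u ∈ ({x, y} : Multiset ℝ), u ∈ S := fun u hu =>
    (Multiset.mem_filter.1 (Multiset.mem_of_le ht hu)).2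
  refine h x (hS x (by simp)) y (hS y (by simp)) ?_
  have h1 := (Multiset.prod_dvd_prod_of_le (Multiset.map_le_map
    (f := fun a => X - C a) (ht.trans (Multiset.filter_le _ _)))).trans
    (prod_multiset_X_sub_C_dvd f)
  simpa using h1

theorem rootCountIn_le_two
    (h : ∀ x ∈ S, ∀ y ∈ S, ∀ z ∈ S, ¬ (X - C x) * ((X - C y) * (X - C z)) ∣ f) :
    rootCountIn f S ≤ 2 := by
  classical
  by_contra hcon
  push Not at hcon
  obtain ⟨t, ht, hc⟩ := Multiset.exists_le_card_eq_of_le_card (n := 3) (s := f.roots.filter (· ∈ S))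
    (by rwa [← rootCountIn_eq_card_filter])
  obtain ⟨x, y, z, rfl⟩ := Multiset.card_eq_three.1 hc
  have hS : ∀ u ∈ ({x, y, z} : Multiset ℝ), u ∈ S := fun u hu =>
    (Multiset.mem_filter.1 (Multiset.mem_of_le ht hu)).2
  refine h x (hS x (by simp)) y (hS y (by simp)) z (hS z (by simp)) ?_
  have h1 := (Multiset.prod_dvd_prod_of_le (Multiset.map_le_map
    (f := fun a => X - C a) (ht.trans (Multiset.filter_le _ _)))).trans
    (prod_multiset_X_sub_C_dvd f)
  simpa using h1

theorem exists_root_Icc_of_sign_change {a b : ℝ} (hab : a ≤ b)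
    (h : f.eval a * f.eval b ≤ 0) : ∃ x ∈ Set.Icc a b, f.eval x = 0 := by
  have hc : ContinuousOn (fun x => f.eval x) (Set.Icc a b) := f.continuous.continuousOn
  rcases le_total (f.eval a) 0 with ha | ha
  · rcases le_total 0 (f.eval b) with hb | hb
    · exact intermediate_value_Icc hab hc ⟨ha, hb⟩
    · rcases mul_eq_zero.1 (le_antisymm h (mul_nonneg_of_nonpos_of_nonpos ha hb)) with h | h
      · exact ⟨a, ⟨le_rfl, hab⟩, h⟩
      · exact ⟨b, ⟨hab, le_rfl⟩, h⟩
  · rcases le_total (f.eval b) 0 with hb | hb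
    · exact intermediate_value_Icc' hab hc ⟨hb, ha⟩
    · rcases mul_eq_zero.1 (le_antisymm h (mul_nonneg ha hb)) with h | h
      · exact ⟨a, ⟨le_rfl, hab⟩, h⟩
      · exact ⟨b, ⟨hab, le_rfl⟩, h⟩

theorem two_le_rootCountIn_Ioo {a b x : ℝ} (hax : a < x) (hxb : x < b) (ha : 0 < f.eval a)
    (hb : 0 < f.eval b) (hx : f.eval x ≤ 0) : 2 ≤ rootCountIn f (Set.Ioo a b) := by
  have hf : f ≠ 0 := by rintro rfl; simp at ha
  have key : ∀ y, a < y → y < b → f.eval y < 0 → 2 ≤ rootCountIn f (Set.Ioo a b) := by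
    intro y hay hyb hy
    obtain ⟨u, ⟨hu1, hu2⟩, hu⟩ := exists_root_Icc_of_sign_change (f := f) hay.le
      (by nlinarith)
    obtain ⟨v, ⟨hv1, hv2⟩, hv⟩ := exists_root_Icc_of_sign_change (f := f) hyb.le
      (by nlinarith)
    have hua : u ≠ a := by rintro rfl; linarith
    have huy : u ≠ y := by rintro rfl; linarith
    have hvy : v ≠ y := by rintro rfl; linarith
    have hvb : v ≠ b := by rintro rfl; linarith
    have h1 := lt_of_le_of_ne hu1 hua.symm
    have h2 := lt_of_le_of_ne hu2 huy
    have h3 := lt_of_le_of_ne hv1 hvy.symm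
    have h4 := lt_of_le_of_ne hv2 hvb
    exact two_le_rootCountIn_of_ne hf (h2.trans h3).ne hu hv ⟨h1, by linarith⟩
      ⟨by linarith, h4⟩
  rcases hx.lt_or_eq with hx | hx
  · exact key x hax hxb hx
  -- If `f` only touches zero at `x`, without negative values nearby, then `x` is a local minimum
  -- and so a double root.
  · by_cases hd : (derivative f).eval x = 0
    · exact two_le_rootCountIn_of_derivative hf hx hd ⟨hax, hxb⟩
    · by_contra hcon
      refine hd ?_
      have hmin : IsLocalMin (fun y => f.eval y) x := by
        filter_upwards [Ioo_mem_nhds hax hxb] with y hy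
        rw [hx]
        by_contra hy'
        exact hcon (key y hy.1 hy.2 (not_le.1 hy'))
      simpa using hmin.deriv_eq_zero

/-- Counting roots through a partition of the line into the fibres of `idx`. -/
theorem card_roots_eq_sum_rootCountIn {n : ℕ} (idx : ℝ → ℕ) (hidx : ∀ x, idx x < n) :
    f.roots.card = ∑ j ∈ Finset.range n, rootCountIn f {x | idx x = j} := by
  classical
  have h1 : ∀ s : Multiset ℝ, s.card = ∑ j ∈ Finset.range n,
      (s.filter (fun x => idx x = j)).card := by
    intro s
    induction s using Multiset.induction_on with
    | empty => simp
    | cons a s ih =>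
      simp_rw [Multiset.filter_cons, Multiset.card_add, Finset.sum_add_distrib, ← ih]
      have : ∀ j, (if idx a = j then ({a} : Multiset ℝ) else 0).card =
        if idx a = j then 1 else 0 := fun j => by split_ifs <;> simp
      simp_rw [this]
      simp [hidx a]
      omega
  rw [h1]
  refine Finset.sum_congr rfl fun j _ => ?_
  rw [rootCountIn_eq_card_filter]
  rfl

end RootsInIntervals

theorem rootCountIn_congr {f : ℝ[X]} {S T : Set ℝ}
    (h : ∀ x, f.eval x = 0 → (x ∈ S ↔ x ∈ T)) : rootCountIn f S = rootCountIn f T := by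
  classical
  rw [rootCountIn_eq_card_filter, rootCountIn_eq_card_filter]
  congr 1
  exact Multiset.filter_congr fun x hx => h x (mem_roots'.1 hx).2

/-! ### The gaps between consecutive points. -/

section Gaps

variable {e : ℕ} {μ : Fin e → ℝ}

/-- The number of points `μ i` to the left of `x`. -/
noncomputable def gapIndex (μ : Fin e → ℝ) (x : ℝ) : ℕ :=
  (Finset.univ.filter fun i => μ i < x).card

/-- The `j`-th connected component of the complement of the points `μ i`. -/
def gap (μ : Fin e → ℝ) (j : ℕ) : Set ℝ :=
  {x | ∀ i : Fin e, ((i : ℕ) < j → μ i < x) ∧ (j ≤ i → x < μ i)}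

theorem gapIndex_lt (x : ℝ) : gapIndex μ x < e + 1 := by
  have := Finset.card_filter_le (Finset.univ : Finset (Fin e)) (fun i => μ i < x)
  rw [Finset.card_univ, Fintype.card_fin] at this
  exact Nat.lt_succ_of_le this

theorem lt_iff_lt_gapIndex (hμ : StrictMono μ) (x : ℝ) (i : Fin e) :
    μ i < x ↔ (i : ℕ) < gapIndex μ x := by
  constructor
  · intro h
    have h1 : Finset.Iic i ⊆ Finset.univ.filter fun i => μ i < x := by
      intro k hk
      simp only [Finset.mem_filter, Finset.mem_univ, true_and]
      exact (hμ.monotone (Finset.mem_Iic.1 hk)).trans_lt h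
    have := Finset.card_le_card h1
    rw [Fin.card_Iic] at this
    exact this
  · intro h
    by_contra hcon
    have h1 : (Finset.univ.filter fun i => μ i < x) ⊆ Finset.Iio i := by
      intro k hk
      simp only [Finset.mem_filter, Finset.mem_univ, true_and] at hk
      rw [Finset.mem_Iio]
      by_contra hki
      exact hcon ((hμ.monotone (not_lt.1 hki)).trans_lt hk)
    have := Finset.card_le_card h1
    rw [Fin.card_Iio] at this
    exact absurd h (not_lt.2 this)

theorem gapIndex_eq_iff (hμ : StrictMono μ) {x : ℝ} (hx : ∀ i, x ≠ μ i) {j : ℕ} (hj : j < e + 1) :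
    gapIndex μ x = j ↔ x ∈ gap μ j := by
  constructor
  · rintro rfl i
    refine ⟨(lt_iff_lt_gapIndex hμ x i).2, fun h => ?_⟩
    exact lt_of_le_of_ne (not_lt.1 fun h' => absurd ((lt_iff_lt_gapIndex hμ x i).1 h')
      (not_lt.2 h)) (hx i)
  · intro h
    have h1 := gapIndex_lt (μ := μ) x
    rcases lt_trichotomy (gapIndex μ x) j with hlt | heq | hgt
    · have := (h ⟨gapIndex μ x, by omega⟩).1 hlt
      exact absurd ((lt_iff_lt_gapIndex hμ x _).1 this) (lt_irrefl _)
    · exact heq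
    · have h2 := (h ⟨j, by omega⟩).2 le_rfl
      have h3 := (lt_iff_lt_gapIndex hμ x ⟨j, by omega⟩).2 hgt
      exact absurd h2 (not_lt.2 h3.le)

theorem gap_succ_eq_Ioo (hμ : StrictMono μ) {j : ℕ} (hj : j + 1 < e) :
    gap μ (j + 1) = Set.Ioo (μ ⟨j, by omega⟩) (μ ⟨j + 1, hj⟩) := by
  ext x
  constructor
  · intro h
    exact ⟨(h ⟨j, by omega⟩).1 (by simp), (h ⟨j + 1, hj⟩).2 (by simp)⟩
  · rintro ⟨h1, h2⟩ i
    refine ⟨fun hi => (hμ.monotone ?_).trans_lt h1, fun hi => h2.trans_le (hμ.monotone ?_)⟩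
    · rw [Fin.le_def]; simpa using Nat.le_of_lt_succ hi
    · rw [Fin.le_def]; simpa using hi

end Gaps

/-! ### Real zeros of the double pole numerator, gap by gap. -/

namespace doublePoleNumerator

variable {e : ℕ} {β μ : Fin (e + 1) → ℝ} {c : ℝ}

/-- The gaps miss only the nodes, where the numerator is positive. -/
theorem card_roots_eq (hβ : ∀ i, 0 < β i) (hμ : StrictMono μ) :
    (doublePoleNumerator β μ c).roots.card =
      ∑ j ∈ Finset.range e, rootCountIn (doublePoleNumerator β μ c) (gap μ (j + 1)) +
        rootCountIn (doublePoleNumerator β μ c) (gap μ 0) +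
        rootCountIn (doublePoleNumerator β μ c) (gap μ (e + 1)) := by
  rw [card_roots_eq_sum_rootCountIn (gapIndex μ) gapIndex_lt]
  have h : ∀ j ∈ Finset.range (e + 1 + 1),
      rootCountIn (doublePoleNumerator β μ c) {x | gapIndex μ x = j} =
      rootCountIn (doublePoleNumerator β μ c) (gap μ j) := by
    intro j hj
    refine rootCountIn_congr fun x hx => ?_
    refine gapIndex_eq_iff hμ ?_ (Finset.mem_range.1 hj)
    rintro i rfl
    exact (eval_pole_pos hβ hμ.injective i).ne' hx
  rw [Finset.sum_congr rfl h, Finset.sum_range_succ, Finset.sum_range_succ']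

theorem rootCountIn_gap_le_two (hβ : ∀ i, 0 < β i) (j : ℕ) :
    rootCountIn (doublePoleNumerator β μ c) (gap μ j) ≤ 2 := by
  have key : ∀ x ∈ gap μ j, ∀ y ∈ gap μ j, ∀ i, 0 < (x - μ i) * (y - μ i) := by
    intro x hx y hy i
    rcases lt_or_ge (i : ℕ) j with h | h
    · exact mul_pos (sub_pos.2 ((hx i).1 h)) (sub_pos.2 ((hy i).1 h))
    · exact mul_pos_of_neg_of_neg (sub_neg.2 ((hx i).2 h)) (sub_neg.2 ((hy i).2 h))
  exact rootCountIn_le_two fun x hx y hy z hz =>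
    not_dvd_three hβ (key x hx y hy) (key y hy z hz)

theorem rootCountIn_gap_zero_le_one (hβ : ∀ i, 0 < β i) :
    rootCountIn (doublePoleNumerator β μ c) (gap μ 0) ≤ 1 := by
  have key : ∀ x ∈ gap μ 0, ∀ i, 0 < (-1) * (x - μ i) := by
    intro x hx i
    have := (hx i).2 (Nat.zero_le _)
    linarith
  exact rootCountIn_le_one fun x hx y hy =>
    not_dvd_two hβ (by norm_num : (-1 : ℝ) ≠ 0) (key x hx) (key y hy)

theorem rootCountIn_gap_last_le_one (hβ : ∀ i, 0 < β i) :
    rootCountIn (doublePoleNumerator β μ c) (gap μ (e + 1)) ≤ 1 := by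
  have key : ∀ x ∈ gap μ (e + 1), ∀ i, 0 < 1 * (x - μ i) := by
    intro x hx i
    have := (hx i).1 i.isLt
    linarith
  exact rootCountIn_le_one fun x hx y hy =>
    not_dvd_two hβ (by norm_num : (1 : ℝ) ≠ 0) (key x hx) (key y hy)

theorem exists_far_radius (hβ : ∀ i, 0 < β i) (hc : 0 < c) :
    ∃ t : ℝ, 0 < t ∧ ∑ i, β i ≤ c * t ^ 2 := by
  have hB : 0 ≤ ∑ i, β i := Finset.sum_nonneg fun i _ => (hβ i).le
  -- With `u = (∑ β i) / c ≥ 0`, the radius `1 + u` works because `(1 + u)² ≥ u`.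
  refine ⟨1 + (∑ i, β i) / c, by positivity, ?_⟩
  have : (∑ i, β i) = c * ((∑ i, β i) / c) := by field_simp
  have h2 : 0 ≤ (∑ i, β i) / c := by positivity
  set u := (∑ i, β i) / c
  rw [this]
  nlinarith [mul_nonneg hc.le h2, mul_nonneg hc.le (mul_nonneg h2 h2)]

theorem one_le_rootCountIn_gap_zero (hβ : ∀ i, 0 < β i) (hμ : StrictMono μ) (hc : 0 < c) :
    1 ≤ rootCountIn (doublePoleNumerator β μ c) (gap μ 0) := by
  obtain ⟨t, ht, hB⟩ := exists_far_radius hβ hc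
  have h1 := eval_nonpos_of_far (μ := μ) (x := μ 0 - t) hβ ht (fun i => by
    have := hμ.monotone (Fin.zero_le i)
    rw [abs_of_neg (by linarith)]
    linarith) hB
  have h2 := eval_pole_pos (c := c) hβ hμ.injective 0
  obtain ⟨x, ⟨-, hx2⟩, hx⟩ := exists_root_Icc_of_sign_change
    (f := doublePoleNumerator β μ c) (a := μ 0 - t) (b := μ 0) (by linarith)
    (mul_nonpos_of_nonpos_of_nonneg h1 h2.le)
  have hx3 : x < μ 0 := lt_of_le_of_ne hx2 (by rintro rfl; exact h2.ne' hx)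
  refine one_le_rootCountIn (ne_zero hβ hμ.injective) hx fun i => ⟨fun h => by omega, fun _ => ?_⟩
  exact hx3.trans_le (hμ.monotone (Fin.zero_le i))

theorem one_le_rootCountIn_gap_last (hβ : ∀ i, 0 < β i) (hμ : StrictMono μ) (hc : 0 < c) :
    1 ≤ rootCountIn (doublePoleNumerator β μ c) (gap μ (e + 1)) := by
  obtain ⟨t, ht, hB⟩ := exists_far_radius hβ hc
  have h1 := eval_nonpos_of_far (μ := μ) (x := μ (Fin.last e) + t) hβ ht (fun i => by
    have := hμ.monotone (Fin.le_last i)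
    rw [abs_of_pos (by linarith)]
    linarith) hB
  have h2 := eval_pole_pos (c := c) hβ hμ.injective (Fin.last e)
  obtain ⟨x, ⟨hx2, -⟩, hx⟩ := exists_root_Icc_of_sign_change
    (f := doublePoleNumerator β μ c) (a := μ (Fin.last e)) (b := μ (Fin.last e) + t)
    (by linarith) (mul_nonpos_of_nonneg_of_nonpos h2.le h1)
  have hx3 : μ (Fin.last e) < x := lt_of_le_of_ne hx2 (by rintro rfl; exact h2.ne' hx)
  refine one_le_rootCountIn (ne_zero hβ hμ.injective) hx fun i => ⟨fun _ => ?_, fun h => by omega⟩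
  exact (hμ.monotone (Fin.le_last i)).trans_lt hx3

theorem two_le_rootCountIn_gap (hβ : ∀ i, 0 < β i) (hμ : StrictMono μ) {j : ℕ} (hj : j < e)
    (h : ∃ x ∈ gap μ (j + 1), (doublePoleNumerator β μ c).eval x ≤ 0) :
    2 ≤ rootCountIn (doublePoleNumerator β μ c) (gap μ (j + 1)) := by
  obtain ⟨x, hx, hx0⟩ := h
  rw [gap_succ_eq_Ioo hμ (by omega)] at hx ⊢
  exact two_le_rootCountIn_Ioo hx.1 hx.2 (eval_pole_pos hβ hμ.injective _)
    (eval_pole_pos hβ hμ.injective _) hx0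

theorem numNonrealZeros_add_card_roots_eq (hc : c ≠ 0) (hβ : ∀ i, 0 < β i) (hμ : StrictMono μ) :
    numNonrealZeros (doublePoleNumerator β μ c) + (doublePoleNumerator β μ c).roots.card =
      2 * (e + 1) := by
  rw [numNonrealZeros_add_card_roots (ne_zero hβ hμ.injective), natDegree_eq_of_ne_zero hc,
    Fintype.card_fin]

/-- For `c > 0` each outer gap takes at least one real zero from the total `2 * (e + 1)`. -/
theorem numNonrealZeros_le (hβ : ∀ i, 0 < β i) (hμ : StrictMono μ) (hc : 0 < c) :
    numNonrealZeros (doublePoleNumerator β μ c) ≤ 2 * e := by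
  have h1 := numNonrealZeros_add_card_roots_eq hc.ne' hβ hμ
  have h2 := card_roots_eq (c := c) hβ hμ
  have h3 := one_le_rootCountIn_gap_zero hβ hμ hc
  have h4 := one_le_rootCountIn_gap_last hβ hμ hc
  omega

theorem numNonrealZeros_eq_zero (hβ : ∀ i, 0 < β i) (hμ : StrictMono μ) (hc : 0 < c)
    (h : ∀ j < e, ∃ x ∈ gap μ (j + 1), (doublePoleNumerator β μ c).eval x ≤ 0) :
    numNonrealZeros (doublePoleNumerator β μ c) = 0 := by
  have h1 := numNonrealZeros_add_card_roots_eq hc.ne' hβ hμ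
  have h2 := card_roots_eq (c := c) hβ hμ
  have h3 := one_le_rootCountIn_gap_zero hβ hμ hc
  have h4 := one_le_rootCountIn_gap_last hβ hμ hc
  have h5 := Finset.sum_le_sum fun j (hj : j ∈ Finset.range e) =>
    two_le_rootCountIn_gap hβ hμ (Finset.mem_range.1 hj) (h j (Finset.mem_range.1 hj))
  simp only [Finset.sum_const, Finset.card_range, smul_eq_mul] at h5
  omega

/-- Real zeros number at most one per outer gap and two per inner gap indexed by `K`; on the
remaining inner gaps the numerator is positive. -/
theorem le_numNonrealZeros (hβ : ∀ i, 0 < β i) (hμ : StrictMono μ) (hc : 0 < c) (K : Finset ℕ)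
    (hK : ∀ j < e, (∃ x ∈ gap μ (j + 1), (doublePoleNumerator β μ c).eval x ≤ 0) → j + 1 ∈ K) :
    2 * e ≤ numNonrealZeros (doublePoleNumerator β μ c) + 2 * K.card := by
  have h1 := numNonrealZeros_add_card_roots_eq hc.ne' hβ hμ
  have h2 := card_roots_eq (c := c) hβ hμ
  have h3 := rootCountIn_gap_zero_le_one (μ := μ) (c := c) hβ
  have h4 := rootCountIn_gap_last_le_one (μ := μ) (c := c) hβ
  have h5 : ∀ j ∈ Finset.range e, rootCountIn (doublePoleNumerator β μ c) (gap μ (j + 1)) ≤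
      if j + 1 ∈ K then 2 else 0 := by
    intro j hj
    split_ifs with hjK
    · exact rootCountIn_gap_le_two hβ _
    · refine (rootCountIn_eq_zero fun x hx hx0 => hjK ?_).le
      exact hK j (Finset.mem_range.1 hj) ⟨x, hx, hx0.le⟩
  have h6 := Finset.sum_le_sum h5
  have h7 : ((Finset.range e).filter fun j => j + 1 ∈ K).card ≤ K.card :=
    Finset.card_le_card_of_injOn (· + 1) (fun j hj => (Finset.mem_filter.1 hj).2)
      (add_left_injective 1).injOn
  rw [← Finset.sum_filter, Finset.sum_const, smul_eq_mul] at h6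
  omega

end doublePoleNumerator

/-! ### The logarithmic derivative and its numerator. -/

/-- The numerator of `∑ k, w k / (X - v k)` over the common denominator `∏ k, (X - v k)`. -/
noncomputable def simplePoleNumerator {ι : Type*} [Fintype ι] [DecidableEq ι] (w v : ι → ℝ) :
    ℝ[X] :=
  ∑ k, C (w k) * Lagrange.nodal (Finset.univ.erase k) v

theorem prod_pow_eq_mul_nodal {ι : Type*} [Fintype ι] (v : ι → ℝ) (mult : ι → ℕ) (hmult : ∀ k, 1 ≤ mult k) :
    ∏ k, (X - C (v k)) ^ mult k =
      (∏ k, (X - C (v k)) ^ (mult k - 1)) * Lagrange.nodal Finset.univ v := by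
  rw [Lagrange.nodal, ← Finset.prod_mul_distrib]
  refine Finset.prod_congr rfl fun k _ => ?_
  rw [← pow_succ, Nat.sub_add_cancel (hmult k)]

section General

variable {ι : Type*} [Fintype ι] [DecidableEq ι]

/-- The quotient rule for `1/(X - v k)`, written as the quotient of the two nodal polynomials and
cleared of denominators. -/
theorem derivative_nodal_erase_wronskian (v : ι → ℝ) (k : ι) :
    derivative (Lagrange.nodal (Finset.univ.erase k) v) * Lagrange.nodal Finset.univ v -
      Lagrange.nodal (Finset.univ.erase k) v * derivative (Lagrange.nodal Finset.univ v) =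
      -Lagrange.nodal (Finset.univ.erase k) v ^ 2 := by
  rw [Lagrange.nodal_eq_mul_nodal_erase (Finset.mem_univ k), derivative_mul, derivative_X_sub_C]
  ring

theorem simplePoleNumerator_wronskian (w v : ι → ℝ) :
    derivative (simplePoleNumerator w v) * Lagrange.nodal Finset.univ v -
      simplePoleNumerator w v * derivative (Lagrange.nodal Finset.univ v) =
      -∑ k, C (w k) * Lagrange.nodal (Finset.univ.erase k) v ^ 2 := by
  rw [simplePoleNumerator, derivative_sum, Finset.sum_mul, Finset.sum_mul,
    ← Finset.sum_sub_distrib, ← Finset.sum_neg_distrib]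
  refine Finset.sum_congr rfl fun k _ => ?_
  rw [derivative_C_mul]
  linear_combination C (w k) * derivative_nodal_erase_wronskian v k

theorem derivative_prod_pow (v : ι → ℝ) (mult : ι → ℕ) (hmult : ∀ k, 1 ≤ mult k) :
    derivative (∏ k, (X - C (v k)) ^ mult k) =
      (∏ k, (X - C (v k)) ^ (mult k - 1)) * simplePoleNumerator (fun k => (mult k : ℝ)) v := by
  rw [derivative_prod_finset, simplePoleNumerator, Finset.mul_sum]
  refine Finset.sum_congr rfl fun k _ => ?_
  have h1 : ∏ i ∈ Finset.univ.erase k, (X - C (v i)) ^ mult i =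
      (∏ i ∈ Finset.univ.erase k, (X - C (v i)) ^ (mult i - 1)) *
        Lagrange.nodal (Finset.univ.erase k) v := by
    rw [Lagrange.nodal, ← Finset.prod_mul_distrib]
    refine Finset.prod_congr rfl fun i _ => ?_
    rw [← pow_succ, Nat.sub_add_cancel (hmult i)]
  rw [h1, ← Finset.mul_prod_erase _ _ (Finset.mem_univ k), derivative_X_sub_C_pow]
  simp only [map_natCast]
  ring

/-- This is `p p'' - κ p'² = p² ((1 - κ) L² + L')` with `L = p'/p = q/r`: the denominator `r²`
cancels against `p²`, leaving the square of `p / r`. -/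
theorem diffPoly_eq_mul (a₀ κ : ℝ) (v : ι → ℝ) (mult : ι → ℕ) (hmult : ∀ k, 1 ≤ mult k) :
    diffPoly κ (C a₀ * ∏ k, (X - C (v k)) ^ mult k) =
      (C a₀ * ∏ k, (X - C (v k)) ^ (mult k - 1)) ^ 2 *
        (C (1 - κ) * simplePoleNumerator (fun k => (mult k : ℝ)) v ^ 2 -
          ∑ k, C (mult k : ℝ) * Lagrange.nodal (Finset.univ.erase k) v ^ 2) := by
  have h0 := simplePoleNumerator_wronskian (fun k => (mult k : ℝ)) v
  have hd := derivative_prod_pow v mult hmult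
  have hp := prod_pow_eq_mul_nodal v mult hmult
  set P := ∏ k, (X - C (v k)) ^ (mult k - 1)
  set q := simplePoleNumerator (fun k => (mult k : ℝ)) v
  set r := Lagrange.nodal Finset.univ v
  have h1 : derivative P * r + P * derivative r = P * q := by
    rw [← derivative_mul, ← hp, hd]
  rw [diffPoly, derivative_C_mul, derivative_C_mul, hd, derivative_mul, hp, C_sub, C_1]
  linear_combination C a₀ ^ 2 * (P ^ 2) * h0 + C a₀ ^ 2 * P * q * h1

theorem eval_simplePoleNumerator (w v : ι → ℝ) {x : ℝ} (hx : ∀ k, x ≠ v k) :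
    (simplePoleNumerator w v).eval x =
      (Lagrange.nodal Finset.univ v).eval x * ∑ k, w k * (x - v k)⁻¹ := by
  rw [simplePoleNumerator, eval_finsetSum, Finset.mul_sum]
  refine Finset.sum_congr rfl fun k _ => ?_
  rw [Lagrange.nodal_eq_mul_nodal_erase (Finset.mem_univ k)]
  have := sub_ne_zero.2 (hx k)
  simp only [eval_mul, eval_C, eval_sub, eval_X]
  field_simp

theorem eval_sum_mul_nodal_erase_sq (w v : ι → ℝ) {x : ℝ} (hx : ∀ k, x ≠ v k) :
    (∑ k, C (w k) * Lagrange.nodal (Finset.univ.erase k) v ^ 2).eval x =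
      (Lagrange.nodal Finset.univ v).eval x ^ 2 * ∑ k, w k * ((x - v k)⁻¹) ^ 2 := by
  rw [eval_finsetSum, Finset.mul_sum]
  refine Finset.sum_congr rfl fun k _ => ?_
  rw [Lagrange.nodal_eq_mul_nodal_erase (Finset.mem_univ k)]
  have := sub_ne_zero.2 (hx k)
  simp only [eval_mul, eval_C, eval_sub, eval_X, eval_pow]
  field_simp

theorem sum_mul_nodal_erase_sq_pos [Nonempty ι] {w v : ι → ℝ} (hw : ∀ k, 0 < w k)
    (hv : Function.Injective v) (x : ℝ) :
    0 < (∑ k, C (w k) * Lagrange.nodal (Finset.univ.erase k) v ^ 2).eval x := by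
  simpa [eval_finsetSum] using doublePoleNumerator.sum_pos hw hv x

theorem coeff_simplePoleNumerator (w v : ι → ℝ) :
    (simplePoleNumerator w v).coeff (Fintype.card ι - 1) = ∑ k, w k := by
  rw [simplePoleNumerator, finsetSum_coeff]
  refine Finset.sum_congr rfl fun k _ => ?_
  have h : (Lagrange.nodal (Finset.univ.erase k) v).natDegree = Fintype.card ι - 1 := by
    rw [Lagrange.natDegree_nodal, Finset.card_erase_of_mem (Finset.mem_univ k), Finset.card_univ]
  rw [coeff_C_mul, ← h, Lagrange.nodal_monic.coeff_natDegree, mul_one]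

theorem natDegree_simplePoleNumerator_le (w v : ι → ℝ) :
    (simplePoleNumerator w v).natDegree ≤ Fintype.card ι - 1 := by
  refine natDegree_sum_le_of_forall_le _ _ fun k _ => (natDegree_C_mul_le _ _).trans ?_
  rw [Lagrange.natDegree_nodal, Finset.card_erase_of_mem (Finset.mem_univ k), Finset.card_univ]

end General

/-! ### Zeros of `L` and partial fractions of `1 / L`. -/

section Interlacing

variable {e : ℕ} {v : Fin (e + 1) → ℝ}

theorem exists_interlacing_root (hv : StrictMono v) (mult : Fin (e + 1) → ℕ)
    (hmult : ∀ k, 1 ≤ mult k) (i : Fin e) : ∃ x, v i.castSucc < x ∧ x < v i.succ ∧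
      (simplePoleNumerator (fun k => (mult k : ℝ)) v).eval x = 0 := by
  set p := ∏ k, (X - C (v k)) ^ mult k with hp
  have hroot : ∀ k, p.eval (v k) = 0 := by
    intro k
    rw [hp, eval_prod]
    refine Finset.prod_eq_zero (Finset.mem_univ k) ?_
    simp [Nat.one_le_iff_ne_zero.1 (hmult k)]
  have hlt : v i.castSucc < v i.succ := hv Fin.castSucc_lt_succ
  obtain ⟨x, hx, hx0⟩ := exists_deriv_eq_zero (f := fun x => p.eval x) hlt
    p.continuous.continuousOn (by simp only [hroot])
  refine ⟨x, hx.1, hx.2, ?_⟩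
  -- Rolle's point is a zero of `p'`; it lies strictly between consecutive poles, so the factor of
  -- repeated roots does not vanish there.
  rw [Polynomial.deriv, hp, derivative_prod_pow v mult hmult, eval_mul] at hx0
  refine (mul_eq_zero.1 hx0).resolve_left ?_
  rw [eval_prod]
  refine Finset.prod_ne_zero_iff.2 fun k _ => ?_
  rw [eval_pow]
  refine pow_ne_zero _ ?_
  simp only [eval_sub, eval_X, eval_C, sub_ne_zero]
  rcases le_or_gt k i.castSucc with h | h
  · exact ((hv.monotone h).trans_lt hx.1).ne'
  · exact (hx.2.trans_le (hv.monotone (Fin.castSucc_lt_iff_succ_le.1 h))).ne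

/-- The zeros of `∑ k, n k / (X - v k)` interlace with its poles. -/
theorem exists_interlacing_factorization (hv : StrictMono v) (mult : Fin (e + 1) → ℕ)
    (hmult : ∀ k, 1 ≤ mult k) : ∃ μ : Fin e → ℝ, StrictMono μ ∧
      (∀ i, v i.castSucc < μ i ∧ μ i < v i.succ) ∧
      simplePoleNumerator (fun k => (mult k : ℝ)) v =
        C (∑ k, (mult k : ℝ)) * Lagrange.nodal Finset.univ μ := by
  choose μ h1 h2 h3 using exists_interlacing_root hv mult hmult
  have hμ : StrictMono μ := by
    intro i j hij
    refine (h2 i).trans ((hv.monotone ?_).trans_lt (h1 j))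
    rw [Fin.le_def]
    simpa using hij
  refine ⟨μ, hμ, fun i => ⟨h1 i, h2 i⟩, ?_⟩
  -- Both sides have degree at most `e` and the same coefficient at `e`, so the difference has
  -- degree below `e` and vanishes at the `e` points `μ i`.
  refine eq_of_degree_sub_lt_of_eval_index_eq Finset.univ hμ.injective.injOn ?_
    fun i _ => ?_
  · rw [Finset.card_univ, Fintype.card_fin]
    refine (degree_lt_iff_coeff_zero _ _).2 fun k hk => ?_
    have hd := natDegree_simplePoleNumerator_le (fun k => (mult k : ℝ)) v
    have hc := coeff_simplePoleNumerator (fun k => (mult k : ℝ)) v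
    rw [Fintype.card_fin, Nat.add_sub_cancel] at hd hc
    have hN : (Lagrange.nodal Finset.univ μ).natDegree = e := by simp [Lagrange.natDegree_nodal]
    rw [coeff_sub, coeff_C_mul]
    rcases hk.eq_or_lt with rfl | hk
    · rw [hc]
      have := (Lagrange.nodal_monic (s := Finset.univ) (v := μ)).coeff_natDegree
      rw [hN] at this
      rw [this]
      ring
    · rw [coeff_eq_zero_of_natDegree_lt (hd.trans_lt hk),
        coeff_eq_zero_of_natDegree_lt (hN.trans_lt hk)]
      ring
  · rw [h3, eval_mul, Lagrange.eval_nodal_at_node (Finset.mem_univ i), mul_zero]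

/-- Up to the factor `n`, this expands `1/L`: the degrees differ by one and both polynomials are
monic, so the quotient is `X + C s`, and the remainder is Lagrange-interpolated at the simple roots
`μ i`. -/
theorem exists_partial_fractions {μ : Fin e → ℝ} (hμ : StrictMono μ) :
    ∃ (s : ℝ) (β : Fin e → ℝ), Lagrange.nodal Finset.univ v =
      Lagrange.nodal Finset.univ μ * (X + C s) -
        ∑ i, C (β i) * Lagrange.nodal (Finset.univ.erase i) μ := by
  set r := Lagrange.nodal Finset.univ v with hr
  set Q := Lagrange.nodal Finset.univ μ with hQ
  have hQm : Q.Monic := Lagrange.nodal_monic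
  have hrm : r.Monic := Lagrange.nodal_monic
  have hQd : Q.natDegree = e := by simp [hQ, Lagrange.natDegree_nodal]
  have hrd : r.natDegree = e + 1 := by simp [hr, Lagrange.natDegree_nodal]
  have hdm : (r /ₘ Q).natDegree = 1 := by rw [natDegree_divByMonic _ hQm, hQd, hrd]; omega
  have hmon : (r /ₘ Q).Monic := by
    rw [Monic, leadingCoeff_divByMonic_of_monic hQm ?_]
    · exact hrm
    · rw [degree_eq_natDegree hQm.ne_zero, degree_eq_natDegree hrm.ne_zero, hQd, hrd]
      exact_mod_cast Nat.le_succ e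
  obtain ⟨s, hs⟩ : ∃ s, r /ₘ Q = X + C s := ⟨_, hmon.eq_X_add_C hdm⟩
  have hne : ∀ i, (Lagrange.nodal (Finset.univ.erase i) μ).eval (μ i) ≠ 0 := fun i =>
    Lagrange.eval_nodal_not_at_node fun j hj hij =>
      Finset.ne_of_mem_erase hj (hμ.injective hij.symm)
  refine ⟨s, fun i => -((r %ₘ Q).eval (μ i) /
    (Lagrange.nodal (Finset.univ.erase i) μ).eval (μ i)), ?_⟩
  have key : r %ₘ Q = ∑ i, C ((r %ₘ Q).eval (μ i) /
      (Lagrange.nodal (Finset.univ.erase i) μ).eval (μ i)) *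
        Lagrange.nodal (Finset.univ.erase i) μ := by
    refine eq_of_degrees_lt_of_eval_index_eq Finset.univ hμ.injective.injOn ?_ ?_ ?_
    · have := degree_modByMonic_lt r hQm
      rwa [hQ, Lagrange.degree_nodal] at this
    · refine (degree_sum_le _ _).trans_lt ?_
      rw [Finset.sup_lt_iff (by simp)]
      intro i _
      refine (degree_le_natDegree.trans
        (Nat.cast_le.2 (natDegree_C_mul_le _ _))).trans_lt ?_
      rw [Lagrange.natDegree_nodal]
      exact_mod_cast Finset.card_erase_lt_of_mem (Finset.mem_univ i)
    · intro i _
      rw [eval_finsetSum, Finset.sum_eq_single i]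
      · rw [eval_mul, eval_C, div_mul_cancel₀ _ (hne i)]
      · intro j _ hj
        rw [eval_mul, Lagrange.eval_nodal_at_node (Finset.mem_erase.2 ⟨hj.symm, Finset.mem_univ i⟩),
          mul_zero]
      · intro h
        exact absurd (Finset.mem_univ i) h
  have h := modByMonic_add_div r Q
  rw [hs] at h
  conv_lhs => rw [← h, key]
  simp only [C_neg, neg_mul, Finset.sum_neg_distrib]
  ring

/-- `a L² + L'` for `L = ∑ k, n k / (X - v k)`, rewritten by means of the partial fraction
decomposition of `1 / L`. -/
theorem exists_doublePoleNumerator (hv : StrictMono v) (mult : Fin (e + 1) → ℕ)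
    (hmult : ∀ k, 1 ≤ mult k) : ∃ (μ β : Fin e → ℝ), StrictMono μ ∧ (∀ i, 0 < β i) ∧
      (∀ i, v i.castSucc < μ i ∧ μ i < v i.succ) ∧
      (∀ i, (simplePoleNumerator (fun k => (mult k : ℝ)) v).eval (μ i) = 0) ∧
      ∀ a : ℝ, C a * simplePoleNumerator (fun k => (mult k : ℝ)) v ^ 2 -
          ∑ k, C (mult k : ℝ) * Lagrange.nodal (Finset.univ.erase k) v ^ 2 =
        C (-∑ k, (mult k : ℝ)) * doublePoleNumerator β μ (a * (∑ k, (mult k : ℝ)) - 1) := by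
  obtain ⟨μ, hμ, hint, hq⟩ := exists_interlacing_factorization hv mult hmult
  obtain ⟨s, β, hr⟩ := exists_partial_fractions (v := v) hμ
  have hw := simplePoleNumerator_wronskian (fun k => (mult k : ℝ)) v
  have hmpos : ∀ k, 0 < (mult k : ℝ) := fun k => by exact_mod_cast hmult k
  have hn : 0 < ∑ k, (mult k : ℝ) := Finset.sum_pos (fun k _ => hmpos k) Finset.univ_nonempty
  have hS := sum_mul_nodal_erase_sq_pos hmpos hv.injective
  set q := simplePoleNumerator (fun k => (mult k : ℝ)) v
  set n := ∑ k, (mult k : ℝ)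
  set r := Lagrange.nodal Finset.univ v
  set S := ∑ k, C (mult k : ℝ) * Lagrange.nodal (Finset.univ.erase k) v ^ 2
  set Q := Lagrange.nodal Finset.univ μ with hQ
  -- This is `(r/Q)' = 1 + ∑ β i / (X - μ i)²`, multiplied by `-Q²`.
  have hB : derivative Q * r - Q * derivative r =
      -(Q ^ 2 + ∑ i, C (β i) * Lagrange.nodal (Finset.univ.erase i) μ ^ 2) := by
    have h1 : ∑ i, C (β i) * (derivative (Lagrange.nodal (Finset.univ.erase i) μ) * Q -
        Lagrange.nodal (Finset.univ.erase i) μ * derivative Q) =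
        -∑ i, C (β i) * Lagrange.nodal (Finset.univ.erase i) μ ^ 2 := by
      rw [← Finset.sum_neg_distrib]
      refine Finset.sum_congr rfl fun i _ => ?_
      rw [derivative_nodal_erase_wronskian]
      ring
    have h2 : ∑ i, C (β i) * (derivative (Lagrange.nodal (Finset.univ.erase i) μ) * Q -
        Lagrange.nodal (Finset.univ.erase i) μ * derivative Q) =
        derivative (∑ i, C (β i) * Lagrange.nodal (Finset.univ.erase i) μ) * Q -
        (∑ i, C (β i) * Lagrange.nodal (Finset.univ.erase i) μ) * derivative Q := by
      rw [derivative_sum, Finset.sum_mul, Finset.sum_mul, ← Finset.sum_sub_distrib]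
      refine Finset.sum_congr rfl fun i _ => ?_
      rw [derivative_C_mul]
      ring
    rw [h2] at h1
    rw [hr, derivative_sub, derivative_mul, derivative_add, derivative_X, derivative_C]
    linear_combination h1
  have hG : S = C n * (Q ^ 2 + ∑ i, C (β i) * Lagrange.nodal (Finset.univ.erase i) μ ^ 2) := by
    rw [hq, derivative_C_mul] at hw
    linear_combination hw - C n * hB
  refine ⟨μ, β, hμ, fun i => ?_, hint, fun i => ?_, fun a => ?_⟩
  -- At `μ i` only the `i`-th term of `hG` survives, so the positive value of `S` there is `n * β i`
  -- times a square.
  · have h1 := hS (μ i)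
    rw [hG, eval_mul, eval_C, eval_add, eval_pow, hQ,
      Lagrange.eval_nodal_at_node (Finset.mem_univ i), eval_finsetSum,
      Finset.sum_eq_single i (fun j _ hj => by
        rw [eval_mul, eval_pow,
          Lagrange.eval_nodal_at_node (Finset.mem_erase.2 ⟨hj.symm, Finset.mem_univ i⟩)]
        ring) (fun h => absurd (Finset.mem_univ i) h)] at h1
    simp only [eval_mul, eval_C, eval_pow] at h1
    by_contra hβ
    push Not at hβ
    have h2 := pos_of_mul_pos_right h1 hn.le
    nlinarith [sq_nonneg (eval (μ i) (Lagrange.nodal (Finset.univ.erase i) μ))]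
  · rw [hq, eval_mul, Lagrange.eval_nodal_at_node (Finset.mem_univ i), mul_zero]
  · rw [hG, hq, doublePoleNumerator]
    simp only [C_neg, C_sub, C_mul, C_1]
    ring

end Interlacing

/-- A combinatorial bound for a set of indices of two kinds, whose distances from the left
(respectively right) end of `[0, e + 1]` are small. -/
theorem card_lt_of_left_or_right {K : Finset ℕ} {P Q : ℕ → Prop} {e s : ℕ} (hs : 0 < s)
    (hK : ∀ j ∈ K, 1 ≤ j ∧ j ≤ e) (hPQ : ∀ j ∈ K, P j ∨ Q j) (hP : ∀ j ∈ K, P j → j < s)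
    (hQ : ∀ j ∈ K, Q j → e + 1 - j < s)
    (hlt : ∀ i ∈ K, ∀ j ∈ K, P i → Q j → i < j → i + (e + 1 - j) < s) : K.card < s := by
  classical
  have hcard : ∀ i j : ℕ, (∀ k ∈ K, k ≤ i ∨ j ≤ k) → K.card ≤ i + (e + 1 - j) := by
    intro i j h
    have hsub : K ⊆ Finset.Icc 1 i ∪ Finset.Icc j e := by
      intro k hk
      have h1 := hK k hk
      rcases h k hk with h2 | h2
      · exact Finset.mem_union_left _ (Finset.mem_Icc.2 ⟨h1.1, h2⟩)
      · exact Finset.mem_union_right _ (Finset.mem_Icc.2 ⟨h2, h1.2⟩)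
    have := (Finset.card_le_card hsub).trans (Finset.card_union_le _ _)
    rw [Nat.card_Icc, Nat.card_Icc] at this
    omega
  by_cases hL : (K.filter P).Nonempty
  · obtain ⟨i, hi, himax⟩ := (K.filter P).exists_max_image id hL
    obtain ⟨hiK, hiP⟩ := Finset.mem_filter.1 hi
    by_cases hR : (K.filter fun j => i < j).Nonempty
    · obtain ⟨j, hj, hjmin⟩ := (K.filter fun j => i < j).exists_min_image id hR
      obtain ⟨hjK, hij⟩ := Finset.mem_filter.1 hj
      -- With `i` the largest index of kind `P` and `j` the next element of `K`, no element lies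
      -- strictly between them, and `j` must be of kind `Q`.
      have hjQ : Q j := (hPQ j hjK).resolve_left fun hjP =>
        absurd (himax j (Finset.mem_filter.2 ⟨hjK, hjP⟩)) (not_le.2 hij)
      refine (hcard i j fun k hk => ?_).trans_lt (hlt i hiK j hjK hiP hjQ hij)
      rcases le_or_gt k i with h | h
      · exact Or.inl h
      · exact Or.inr (hjmin k (Finset.mem_filter.2 ⟨hk, h⟩))
    · have := hcard i (e + 1) fun k hk => Or.inl (not_lt.1 fun h =>
        hR ⟨k, Finset.mem_filter.2 ⟨hk, h⟩⟩)
      have := hP i hiK hiP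
      omega
  · have hall : ∀ j ∈ K, Q j := fun j hj => (hPQ j hj).resolve_left fun h =>
      hL ⟨j, Finset.mem_filter.2 ⟨hj, h⟩⟩
    rcases K.eq_empty_or_nonempty with rfl | hne
    · simpa using hs
    · obtain ⟨j, hj, hjmin⟩ := K.exists_min_image id hne
      have := hcard 0 j fun k hk => Or.inr (hjmin k hk)
      have := hQ j hj (hall j hj)
      omega

theorem inv_sub_lt_inv_sub {x y t : ℝ} (hyx : y < x) (h : 0 < (x - t) * (y - t)) :
    (x - t)⁻¹ < (y - t)⁻¹ := by
  have hx : x - t ≠ 0 := left_ne_zero_of_mul h.ne'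
  have hy : y - t ≠ 0 := right_ne_zero_of_mul h.ne'
  have : (y - t)⁻¹ - (x - t)⁻¹ = (x - y) / ((x - t) * (y - t)) := by
    field_simp
    ring
  have h2 := div_pos (sub_pos.2 hyx) h
  linarith

/-! ### Reversed Cauchy–Schwarz and the deletion of poles. -/

section WeightedSums

variable {ι : Type*} [Fintype ι] [DecidableEq ι] {w t : ι → ℝ} {N : ℝ}

/-- If the weighted Cauchy–Schwarz defect is small, then a negative sum must stay negative after
the removal of a set of small weight. -/
theorem sum_compl_neg (hw : ∀ k, 0 < w k) (hN : 0 < N) (hneg : ∑ k, w k * t k < 0)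
    (hCS : N * ∑ k, w k * t k ^ 2 ≤ (∑ k, w k * t k) ^ 2) (M : Finset ι) (hM : ∑ k ∈ M, w k ≤ N)
    (hne : ∃ k ∉ M, t k ≠ 0) : ∑ k ∈ Mᶜ, w k * t k < 0 := by
  by_contra hD
  push Not at hD
  obtain ⟨k₀, hk₀, htk₀⟩ := hne
  rw [← Finset.sum_add_sum_compl M] at hneg hCS
  rw [← Finset.sum_add_sum_compl M (fun k => w k * t k)] at hCS
  have hpos : 0 < ∑ k ∈ Mᶜ, w k * t k ^ 2 :=
    Finset.sum_pos' (fun k _ => mul_nonneg (hw k).le (sq_nonneg _))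
      ⟨k₀, Finset.mem_compl.2 hk₀, mul_pos (hw k₀) (by positivity)⟩
  have hnn : 0 ≤ ∑ k ∈ M, w k * t k ^ 2 :=
    Finset.sum_nonneg fun k _ => mul_nonneg (hw k).le (sq_nonneg _)
  -- If the complement contributed `≥ 0` to a negative total, the total would be no larger in
  -- absolute value than the sum over `M`, which Cauchy–Schwarz on `M` makes too small for `hCS`.
  have h1 : (∑ k ∈ M, w k * t k) ^ 2 ≤ (∑ k ∈ M, w k) * ∑ k ∈ M, w k * t k ^ 2 := by
    refine Finset.sum_sq_le_sum_mul_sum_of_sq_le_mul M (fun k _ => (hw k).le)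
      (fun k _ => mul_nonneg (hw k).le (sq_nonneg _)) fun k _ => le_of_eq (by ring)
  have h2 := mul_le_mul_of_nonneg_right hM hnn
  have h3 := mul_pos hN hpos
  nlinarith

theorem sum_compl_pos (hw : ∀ k, 0 < w k) (hN : 0 < N) (hpos : 0 < ∑ k, w k * t k)
    (hCS : N * ∑ k, w k * t k ^ 2 ≤ (∑ k, w k * t k) ^ 2) (M : Finset ι) (hM : ∑ k ∈ M, w k ≤ N)
    (hne : ∃ k ∉ M, t k ≠ 0) : 0 < ∑ k ∈ Mᶜ, w k * t k := by
  have h := sum_compl_neg (t := fun k => -t k) hw hN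
    (by simpa [Finset.sum_neg_distrib] using hpos)
    (by simpa [Finset.sum_neg_distrib] using hCS) M hM (by simpa using hne)
  simpa [Finset.sum_neg_distrib] using h

theorem card_compl_le_sub (hw : ∀ k, 1 ≤ w k) (M : Finset ι) :
    ((Mᶜ.card : ℕ) : ℝ) ≤ ∑ k, w k - ∑ k ∈ M, w k := by
  have h1 : ((Mᶜ.card : ℕ) : ℝ) ≤ ∑ k ∈ Mᶜ, w k := by
    simpa using Finset.sum_le_sum fun k (_ : k ∈ Mᶜ) => hw k
  have := Finset.sum_add_sum_compl M w
  linarith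

end WeightedSums

/-! ### Bounding the number of inner gaps that meet `a L² + L' ≥ 0`. -/

section Bound

variable {e : ℕ} {v : Fin (e + 2) → ℝ} {μ : Fin (e + 1) → ℝ}

theorem lt_of_mem_gap (hv : StrictMono v) (hint : ∀ i, v i.castSucc < μ i ∧ μ i < v i.succ)
    {j : ℕ} {x : ℝ} (hj : 1 ≤ j) (hx : x ∈ gap μ j) {k : Fin (e + 2)} (hk : (k : ℕ) < j)
    (hje : j ≤ e) :
    v k < x := by
  have h1 := (hint ⟨j - 1, by omega⟩).1
  have h2 := (hx ⟨j - 1, by omega⟩).1 (by simp; omega)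
  refine (hv.monotone ?_).trans_lt (h1.trans h2)
  rw [Fin.le_def]
  simp
  omega

theorem gt_of_mem_gap (hv : StrictMono v) (hint : ∀ i, v i.castSucc < μ i ∧ μ i < v i.succ)
    {j : ℕ} {x : ℝ} (hx : x ∈ gap μ j) {k : Fin (e + 2)} (hk : j < (k : ℕ)) (hje : j ≤ e) :
    x < v k := by
  have h1 := (hint ⟨j, by omega⟩).2
  have h2 := (hx ⟨j, by omega⟩).2 le_rfl
  refine (h2.trans h1).trans_le (hv.monotone ?_)
  rw [Fin.le_def]
  simp
  omega

/-- The pole `v j` lies in the `j`-th gap. -/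
theorem mem_gap_self (hv : StrictMono v) (hint : ∀ i, v i.castSucc < μ i ∧ μ i < v i.succ)
    (j : Fin (e + 2)) : v j ∈ gap μ j := by
  intro i
  refine ⟨fun h => (hint i).2.trans_le (hv.monotone ?_), fun h =>
    (hv.monotone ?_).trans_lt (hint i).1⟩
  · rw [Fin.le_def, Fin.val_succ]
    omega
  · rw [Fin.le_def, Fin.val_castSucc]
    exact h

/-- Data attached to a point `x` of the `j`-th gap at which `a L² + L' ≥ 0`, where `a ≤ 1 / N`
and `L = ∑ k, w k / (X - v k)`: the inequality in a form free of denominators. -/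
theorem cauchySchwarz_defect_of_eval_nonneg {w : Fin (e + 2) → ℝ} {a N x : ℝ} (hN : 0 < N)
    (ha : a ≤ 1 / N) (hx : ∀ k, x ≠ v k)
    (h : 0 ≤ (C a * simplePoleNumerator w v ^ 2 -
      ∑ k, C (w k) * Lagrange.nodal (Finset.univ.erase k) v ^ 2).eval x) :
    N * ∑ k, w k * ((x - v k)⁻¹) ^ 2 ≤ (∑ k, w k * (x - v k)⁻¹) ^ 2 := by
  rw [eval_sub, eval_sum_mul_nodal_erase_sq w v hx, eval_mul, eval_C, eval_pow,
    eval_simplePoleNumerator w v hx, mul_pow] at h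
  have hr : 0 < (Lagrange.nodal Finset.univ v).eval x ^ 2 := by
    have := Lagrange.eval_nodal_not_at_node (s := Finset.univ) (v := v) fun k _ => hx k
    positivity
  set S := ∑ k, w k * ((x - v k)⁻¹) ^ 2
  set L := ∑ k, w k * (x - v k)⁻¹
  have h1 : S ≤ a * L ^ 2 := by
    by_contra hcon
    push Not at hcon
    nlinarith
  have h2 : a * L ^ 2 ≤ 1 / N * L ^ 2 := mul_le_mul_of_nonneg_right ha (sq_nonneg _)
  have h3 := mul_le_mul_of_nonneg_left (h1.trans h2) hN.le
  have h4 : N * (1 / N * L ^ 2) = L ^ 2 := by field_simp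
  linarith

/-- `L` decreases strictly between consecutive poles and vanishes at the left end of the gap, so it
is negative from there up to the pole `v j`. -/
theorem sum_neg_of_lt (hv : StrictMono v) (hint : ∀ i, v i.castSucc < μ i ∧ μ i < v i.succ)
    {w : Fin (e + 2) → ℝ} (hw : ∀ k, 0 < w k)
    (hzero : ∀ i, (simplePoleNumerator w v).eval (μ i) = 0) {j : Fin (e + 2)} (hj : 1 ≤ (j : ℕ))
    {x : ℝ} (hx : x ∈ gap μ j) (hxj : x < v j) (hx' : (j : ℕ) ≤ e) :
    ∑ k, w k * (x - v k)⁻¹ < 0 := by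
  set i : Fin (e + 1) := ⟨j - 1, by omega⟩ with hi
  have hμx : μ i < x := (hx i).1 (show (j : ℕ) - 1 < j by omega)
  have hlo : ∀ k : Fin (e + 2), (k : ℕ) < j → v k < μ i := fun k hk =>
    (hv.monotone (by rw [Fin.le_def]; simp [hi]; omega)).trans_lt (hint i).1
  have hhi : ∀ k : Fin (e + 2), (j : ℕ) ≤ k → x < v k := fun k hk =>
    hxj.trans_le (hv.monotone hk)
  have hne : ∀ k, μ i ≠ v k := fun k => by
    rcases lt_or_ge (k : ℕ) j with h | h
    · exact (hlo k h).ne'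
    · exact (hμx.trans (hhi k h)).ne
  have h0 : ∑ k, w k * (μ i - v k)⁻¹ = 0 := by
    have := hzero i
    rw [eval_simplePoleNumerator w v hne] at this
    exact (mul_eq_zero.1 this).resolve_left
      (Lagrange.eval_nodal_not_at_node fun k _ => hne k)
  rw [← h0]
  refine Finset.sum_lt_sum_of_nonempty Finset.univ_nonempty fun k _ =>
    mul_lt_mul_of_pos_left (inv_sub_lt_inv_sub hμx ?_) (hw k)
  rcases lt_or_ge (k : ℕ) j with h | h
  · have := hlo k h
    exact mul_pos (by linarith) (by linarith)
  · have := hhi k h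
    exact mul_pos_of_neg_of_neg (by linarith) (by linarith)

/-- To the right of the pole `v j`, `L` decreases strictly to its zero at the right end of the gap.
-/
theorem sum_pos_of_gt (hv : StrictMono v) (hint : ∀ i, v i.castSucc < μ i ∧ μ i < v i.succ)
    {w : Fin (e + 2) → ℝ} (hw : ∀ k, 0 < w k)
    (hzero : ∀ i, (simplePoleNumerator w v).eval (μ i) = 0) {j : Fin (e + 2)}
    {x : ℝ} (hx : x ∈ gap μ j) (hxj : v j < x) (hx' : (j : ℕ) ≤ e) :
    0 < ∑ k, w k * (x - v k)⁻¹ := by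
  set i : Fin (e + 1) := ⟨j, by omega⟩ with hi
  have hμx : x < μ i := (hx i).2 le_rfl
  have hlo : ∀ k : Fin (e + 2), (k : ℕ) ≤ j → v k < x := fun k hk =>
    (hv.monotone hk).trans_lt hxj
  have hhi : ∀ k : Fin (e + 2), (j : ℕ) < k → μ i < v k := fun k hk =>
    (hint i).2.trans_le (hv.monotone (by rw [Fin.le_def]; simp [hi]; omega))
  have hne : ∀ k, μ i ≠ v k := fun k => by
    rcases le_or_gt (k : ℕ) j with h | h
    · exact ((hlo k h).trans hμx).ne'
    · exact (hhi k h).ne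
  have h0 : ∑ k, w k * (μ i - v k)⁻¹ = 0 := by
    have := hzero i
    rw [eval_simplePoleNumerator w v hne] at this
    exact (mul_eq_zero.1 this).resolve_left
      (Lagrange.eval_nodal_not_at_node fun k _ => hne k)
  rw [← h0]
  refine Finset.sum_lt_sum_of_nonempty Finset.univ_nonempty fun k _ =>
    mul_lt_mul_of_pos_left (inv_sub_lt_inv_sub hμx ?_) (hw k)
  rcases le_or_gt (k : ℕ) j with h | h
  · have := hlo k h
    exact mul_pos (by linarith) (by linarith)
  · have := hhi k h
    exact mul_pos_of_neg_of_neg (by linarith) (by linarith)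

/-- At most `s - 1` inner gaps contain a point with `a L² + L' ≥ 0` if `a ≤ 1 / (n - s)`. -/
theorem card_gaps_lt (hv : StrictMono v) (hint : ∀ i, v i.castSucc < μ i ∧ μ i < v i.succ)
    {w : Fin (e + 2) → ℝ} (hw : ∀ k, 1 ≤ w k)
    (hzero : ∀ i, (simplePoleNumerator w v).eval (μ i) = 0) {a : ℝ} {s : ℕ} (hs : 0 < s)
    (hse : s ≤ e) (ha : a ≤ 1 / (∑ k, w k - s)) {K : Finset ℕ}
    (hK : ∀ j ∈ K, 1 ≤ j ∧ j ≤ e ∧ ∃ x ∈ gap μ j, 0 ≤ (C a * simplePoleNumerator w v ^ 2 -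
      ∑ k, C (w k) * Lagrange.nodal (Finset.univ.erase k) v ^ 2).eval x) : K.card < s := by
  set G := C a * simplePoleNumerator w v ^ 2 -
    ∑ k, C (w k) * Lagrange.nodal (Finset.univ.erase k) v ^ 2 with hG
  have hw0 : ∀ k, 0 < w k := fun k => zero_lt_one.trans_le (hw k)
  set N := ∑ k, w k - s with hNdef
  have hN : 0 < N := by
    have h1 : ((e + 2 : ℕ) : ℝ) ≤ ∑ k, w k := by
      simpa using Finset.sum_le_sum fun k (_ : k ∈ Finset.univ) => hw k
    have h2 : (s : ℝ) ≤ e := by exact_mod_cast hse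
    push_cast at h1
    linarith
  -- a subset with at least `s` points in its complement has weight at most `N`
  have hweight : ∀ M : Finset (Fin (e + 2)), s ≤ Mᶜ.card → ∑ k ∈ M, w k ≤ N := by
    intro M hM
    have h1 := card_compl_le_sub hw M
    have h2 : (s : ℝ) ≤ Mᶜ.card := by exact_mod_cast hM
    linarith
  have hne : ∀ j : ℕ, 1 ≤ j → ∀ hje : j ≤ e, ∀ x ∈ gap μ j, x ≠ v ⟨j, by omega⟩ →
      ∀ k, x ≠ v k := by
    intro j hj hje x hx hxj k
    rcases lt_trichotomy (k : ℕ) j with h | h | h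
    · exact (lt_of_mem_gap hv hint hj hx h hje).ne'
    · have : k = ⟨j, by omega⟩ := Fin.ext h
      rwa [this]
    · exact (gt_of_mem_gap hv hint hx h hje).ne
  set P : ℕ → Prop := fun j => ∃ hj : j ≤ e, ∃ x ∈ gap μ j, x < v ⟨j, by omega⟩ ∧ 0 ≤ G.eval x
    with hP
  set R : ℕ → Prop := fun j => ∃ hj : j ≤ e, ∃ x ∈ gap μ j, v ⟨j, by omega⟩ < x ∧ 0 ≤ G.eval x
    with hR
  have hPdata : ∀ j, 1 ≤ j → P j → ∃ x ∈ gap μ j, (∀ k : Fin (e + 2), j ≤ (k : ℕ) → x < v k) ∧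
      (∀ k, x ≠ v k) ∧ ∑ k, w k * (x - v k)⁻¹ < 0 ∧
      N * ∑ k, w k * ((x - v k)⁻¹) ^ 2 ≤ (∑ k, w k * (x - v k)⁻¹) ^ 2 := by
    rintro j hj ⟨hje, x, hx, hxj, hGx⟩
    have h1 := hne j hj hje x hx hxj.ne
    refine ⟨x, hx, fun k hk => hxj.trans_le (hv.monotone hk), h1, ?_,
      cauchySchwarz_defect_of_eval_nonneg hN ha h1 hGx⟩
    exact sum_neg_of_lt hv hint hw0 hzero (j := ⟨j, by omega⟩) hj hx hxj hje
  have hRdata : ∀ j, 1 ≤ j → R j → ∃ x ∈ gap μ j, (∀ k : Fin (e + 2), (k : ℕ) ≤ j → v k < x) ∧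
      (∀ k, x ≠ v k) ∧ 0 < ∑ k, w k * (x - v k)⁻¹ ∧
      N * ∑ k, w k * ((x - v k)⁻¹) ^ 2 ≤ (∑ k, w k * (x - v k)⁻¹) ^ 2 := by
    rintro j hj ⟨hje, x, hx, hxj, hGx⟩
    have h1 := hne j hj hje x hx hxj.ne'
    refine ⟨x, hx, fun k hk => (hv.monotone hk).trans_lt hxj, h1, ?_,
      cauchySchwarz_defect_of_eval_nonneg hN ha h1 hGx⟩
    exact sum_pos_of_gt hv hint hw0 hzero (j := ⟨j, by omega⟩) hx hxj hje
  refine card_lt_of_left_or_right (P := P) (Q := R) hs (fun j hj => ⟨(hK j hj).1, (hK j hj).2.1⟩)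
    ?_ ?_ ?_ ?_
  · intro j hjK
    obtain ⟨hj, hje, x, hx, hGx⟩ := hK j hjK
    rcases lt_trichotomy x (v ⟨j, by omega⟩) with h | h | h
    · exact Or.inl ⟨hje, x, hx, h, hGx⟩
    -- The pole itself does not qualify: the other `e + 1 > s` poles weigh at least one each, so `w
    -- J < N` and `a * w J < 1`, making the value at `v J` negative.
    · exfalso
      set J : Fin (e + 2) := ⟨j, by omega⟩
      have hlt : w J < N := by
        have h2 := card_compl_le_sub hw {J}
        rw [Finset.card_compl, Fintype.card_fin, Finset.card_singleton] at h2
        have h3 : (s : ℝ) < ((e + 2 - 1 : ℕ) : ℝ) := by exact_mod_cast (by omega)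
        rw [Finset.sum_singleton] at h2
        linarith
      have hz : ∀ k ≠ J, (Lagrange.nodal (Finset.univ.erase k) v).eval (v J) = 0 := fun k hk =>
        Lagrange.eval_nodal_at_node (Finset.mem_erase.2 ⟨hk.symm, Finset.mem_univ _⟩)
      have hnz : (Lagrange.nodal (Finset.univ.erase J) v).eval (v J) ≠ 0 :=
        Lagrange.eval_nodal_not_at_node fun k hk hkJ =>
          Finset.ne_of_mem_erase hk (hv.injective hkJ.symm)
      rw [h, hG, simplePoleNumerator, eval_sub, eval_mul, eval_pow, eval_finsetSum, eval_finsetSum,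
        Finset.sum_eq_single J (fun k _ hk => by rw [eval_mul, hz k hk, mul_zero])
          (fun h => absurd (Finset.mem_univ J) h),
        Finset.sum_eq_single J (fun k _ hk => by
          rw [eval_mul, eval_pow, hz k hk, zero_pow two_ne_zero, mul_zero])
          (fun h => absurd (Finset.mem_univ J) h)] at hGx
      simp only [eval_mul, eval_C, eval_pow] at hGx
      set u := (Lagrange.nodal (Finset.univ.erase J) v).eval (v J)
      have hu : 0 < u ^ 2 := by positivity
      have h4 : a * w J < 1 := by
        have h5 := mul_le_mul_of_nonneg_right ha (hw0 J).le
        have h6 : 1 / N * w J < 1 := by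
          rw [one_div, inv_mul_lt_iff₀ hN]
          linarith
        linarith
      have h7 : a * (w J * u) ^ 2 - w J * u ^ 2 = -((1 - a * w J) * (w J * u ^ 2)) := by ring
      rw [h7] at hGx
      have := mul_pos (sub_pos.2 h4) (mul_pos (hw0 J) hu)
      linarith
    · exact Or.inr ⟨hje, x, hx, h, hGx⟩
  · intro j hjK hPj
    have hj := (hK j hjK).1
    have hje := (hK j hjK).2.1
    obtain ⟨x, hx, -, hxne, hL, hCS⟩ := hPdata j hj hPj
    by_contra hcon
    push Not at hcon
    -- Deleting all poles to the right of `x` leaves only positive terms, although `L` is negative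
    -- at `x`. This is impossible if the `j` poles on the left number at least `s`.
    set M : Finset (Fin (e + 2)) := Finset.Ici ⟨j, by omega⟩ with hM
    have hMc : Mᶜ = Finset.Iio ⟨j, by omega⟩ := by ext k; simp [hM]
    have h1 := sum_compl_neg hw0 hN hL hCS M (hweight M (by rw [hMc, Fin.card_Iio]; exact hcon))
      ⟨0, by simp [hM]; omega, inv_ne_zero (sub_ne_zero.2 (hxne 0))⟩
    refine absurd h1 (not_lt.2 (Finset.sum_nonneg fun k hk => ?_))
    rw [hMc, Finset.mem_Iio, Fin.lt_def] at hk
    have := lt_of_mem_gap hv hint hj hx hk hje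
    exact mul_nonneg (hw0 k).le (inv_nonneg.2 (by linarith))
  · intro j hjK hRj
    have hj := (hK j hjK).1
    have hje := (hK j hjK).2.1
    obtain ⟨x, hx, -, hxne, hL, hCS⟩ := hRdata j hj hRj
    by_contra hcon
    push Not at hcon
    -- Mirror image: the poles left of `x` are deleted, and `e + 1 - j` poles remain.
    set M : Finset (Fin (e + 2)) := Finset.Iic ⟨j, by omega⟩ with hM
    have hMc : Mᶜ = Finset.Ioi ⟨j, by omega⟩ := by ext k; simp [hM]
    have h1 := sum_compl_pos hw0 hN hL hCS M
      (hweight M (by rw [hMc, Fin.card_Ioi]; simp only; omega))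
      ⟨Fin.last _, by simp [hM, Fin.le_def]; omega,
        inv_ne_zero (sub_ne_zero.2 (hxne (Fin.last _)))⟩
    refine absurd h1 (not_lt.2 (Finset.sum_nonpos fun k hk => ?_))
    rw [hMc, Finset.mem_Ioi, Fin.lt_def] at hk
    have := gt_of_mem_gap hv hint hx hk hje
    exact mul_nonpos_of_nonneg_of_nonpos (hw0 k).le (inv_nonpos.2 (by linarith))
  · intro i hiK j hjK hPi hRj hij
    have hi := (hK i hiK).1
    have hie := (hK i hiK).2.1
    have hj := (hK j hjK).1
    have hje := (hK j hjK).2.1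
    obtain ⟨x, hx, hxi, hxne, hLx, hCSx⟩ := hPdata i hi hPi
    obtain ⟨y, hy, hyj, hyne, hLy, hCSy⟩ := hRdata j hj hRj
    by_contra hcon
    push Not at hcon
    -- After deleting the poles from `v i` to `v j`, the remaining sum has no pole between `x` and
    -- `y`, so it decreases from `x` to `y`; yet it would be negative at `x` and positive at `y`.
    set M : Finset (Fin (e + 2)) := Finset.Icc ⟨i, by omega⟩ ⟨j, by omega⟩ with hM
    have hMcard : s ≤ Mᶜ.card := by
      rw [Finset.card_compl, Fintype.card_fin, hM, Fin.card_Icc]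
      simp only
      omega
    have h0 : (0 : Fin (e + 2)) ∉ M := by
      simp [hM]; omega
    have h1 := sum_compl_neg hw0 hN hLx hCSx M (hweight M hMcard)
      ⟨0, h0, inv_ne_zero (sub_ne_zero.2 (hxne 0))⟩
    have h2 := sum_compl_pos hw0 hN hLy hCSy M (hweight M hMcard)
      ⟨0, h0, inv_ne_zero (sub_ne_zero.2 (hyne 0))⟩
    have hxy : x < y := (hxi ⟨i, by omega⟩ le_rfl).trans (hyj ⟨i, by omega⟩ hij.le)
    have h3 : ∑ k ∈ Mᶜ, w k * (y - v k)⁻¹ ≤ ∑ k ∈ Mᶜ, w k * (x - v k)⁻¹ := by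
      refine Finset.sum_le_sum fun k hk => mul_le_mul_of_nonneg_left
        (inv_sub_lt_inv_sub hxy ?_).le (hw0 k).le
      rw [Finset.mem_compl, hM, Finset.mem_Icc, Fin.le_def, Fin.le_def] at hk
      rcases lt_or_ge (k : ℕ) i with h | h
      · have := lt_of_mem_gap hv hint hi hx h hie
        exact mul_pos (by linarith) (by linarith)
      · have hjk : j < (k : ℕ) := by
          by_contra h'
          exact hk ⟨h, not_lt.1 h'⟩
        have := gt_of_mem_gap hv hint hy hjk hje
        exact mul_pos_of_neg_of_neg (by linarith) (by linarith)
    linarith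

end Bound

/-! ### Reduction to double poles and the case analysis in `κ`. -/

/-- Dividing out the multiple zeros of `p` and a constant, which have no non-real zeros, leaves
the numerator of a function with double poles only. -/
theorem numNonrealZeros_diffPoly_eq {e : ℕ} {v : Fin (e + 1) → ℝ} {mult : Fin (e + 1) → ℕ}
    (hmult : ∀ k, 1 ≤ mult k) {a₀ : ℝ} (ha₀ : a₀ ≠ 0) (κ : ℝ) {H : ℝ[X]} (hH : H ≠ 0)
    (h : C (1 - κ) * simplePoleNumerator (fun k => (mult k : ℝ)) v ^ 2 -
        ∑ k, C (mult k : ℝ) * Lagrange.nodal (Finset.univ.erase k) v ^ 2 =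
      C (-∑ k, (mult k : ℝ)) * H) :
    numNonrealZeros (diffPoly κ (realRootedPoly a₀ v mult)) = numNonrealZeros H := by
  have hn : -∑ k, (mult k : ℝ) ≠ 0 := by
    refine neg_ne_zero.2 (Finset.sum_pos (fun k _ => ?_) Finset.univ_nonempty).ne'
    exact_mod_cast hmult k
  have hP : C a₀ * ∏ k, (X - C (v k)) ^ (mult k - 1) ≠ 0 :=
    mul_ne_zero (C_ne_zero.2 ha₀) (Finset.prod_ne_zero_iff.2 fun k _ =>
      pow_ne_zero _ (X_sub_C_ne_zero _))
  have hPs : (C a₀ * ∏ k, (X - C (v k)) ^ (mult k - 1)).Splits :=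
    (Splits.C a₀).mul (Splits.prod fun k _ => (Splits.X_sub_C (v k)).pow _)
  rw [realRootedPoly, diffPoly_eq_mul a₀ κ v mult hmult, h,
    numNonrealZeros_mul (pow_ne_zero _ hP) (mul_ne_zero (C_ne_zero.2 hn) hH),
    numNonrealZeros_mul (C_ne_zero.2 hn) hH,
    numNonrealZeros_eq_zero_of_splits (hPs.pow 2),
    numNonrealZeros_eq_zero_of_splits (Splits.C _)]
  omega

theorem theorem2p2 (d : ℕ) (hd : 3 ≤ d) (a₀ : ℝ) (ha₀ : a₀ ≠ 0)
    (lam : Fin d → ℝ) (hlam : StrictMono lam)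
    (mult : Fin d → ℕ) (hmult : ∀ k, 1 ≤ mult k)
    (m : ℕ) (hm : ∀ k : Fin d, 0 < (k : ℕ) → (k : ℕ) + 1 < d → mult k = m)
    (p : ℝ[X]) (hp : p = realRootedPoly a₀ lam mult)
    (n : ℕ) (hn : n = ∑ k, mult k) (κ : ℝ) :
    (κ ≤ ((m : ℝ) - 1) / m → numNonrealZeros (diffPoly κ p) = 0) ∧
    (((m : ℝ) - 1) / m < κ →
      (κ < ((n : ℝ) - d + 1) / ((n : ℝ) - d + 2) →
        0 ≤ (numNonrealZeros (diffPoly κ p) : ℤ) ∧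
          (numNonrealZeros (diffPoly κ p) : ℤ) ≤ 2 * (d : ℤ) - 4) ∧
      (∀ k : ℕ, 2 ≤ k → k ≤ d - 1 →
        ((n : ℝ) - d + k - 1) / ((n : ℝ) - d + k) ≤ κ →
        κ < ((n : ℝ) - d + k) / ((n : ℝ) - d + k + 1) →
        2 * (k : ℤ) - 2 ≤ (numNonrealZeros (diffPoly κ p) : ℤ) ∧
          (numNonrealZeros (diffPoly κ p) : ℤ) ≤ 2 * (d : ℤ) - 4) ∧
      (κ = ((n : ℝ) - 1) / n →
        (numNonrealZeros (diffPoly κ p) : ℤ) = 2 * (d : ℤ) - 4) ∧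
      (((n : ℝ) - 1) / n < κ →
        (numNonrealZeros (diffPoly κ p) : ℤ) = 2 * (d : ℤ) - 2)) := by
  classical
  obtain ⟨e, rfl⟩ : ∃ e, d = e + 2 := ⟨d - 2, by omega⟩
  obtain ⟨μ, β, hμ, hβ, hint, hzero, hfact⟩ := exists_doublePoleNumerator hlam mult hmult
  have hnR : (n : ℝ) = ∑ k, (mult k : ℝ) := by rw [hn]; push_cast; rfl
  have hfact' := hfact (1 - κ)
  rw [← hnR] at hfact'
  set c := (1 - κ) * (n : ℝ) - 1 with hc
  have hZ : numNonrealZeros (diffPoly κ p) = numNonrealZeros (doublePoleNumerator β μ c) := by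
    rw [hp]
    refine numNonrealZeros_diffPoly_eq hmult ha₀ κ
      (doublePoleNumerator.ne_zero hβ hμ.injective) ?_
    rw [← hnR]
    exact hfact'
  have hnd : ((e : ℝ) + 2) ≤ n := by
    have h1 := Finset.sum_le_sum fun k (_ : k ∈ Finset.univ) => hmult k
    simp only [Finset.sum_const, Finset.card_univ, Fintype.card_fin, smul_eq_mul, mul_one] at h1
    rw [← hn] at h1
    exact_mod_cast h1
  have he : 1 ≤ e := by omega
  have heR : (1 : ℝ) ≤ e := by exact_mod_cast he
  have hn0 : (0 : ℝ) < n := by linarith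
  -- the sign of `c` is governed by the position of `κ` with respect to `(n - 1) / n`
  have hfrac : ∀ t : ℝ, 0 < t → (t - 1) / t = 1 - 1 / t := fun t ht => by field_simp
  have hcpos : ∀ t : ℝ, 0 < t → t ≤ n → κ < (t - 1) / t → 0 < c := by
    intro t ht htn h
    rw [hfrac t ht] at h
    have h1 : 1 / t < 1 - κ := by linarith
    rw [div_lt_iff₀ ht] at h1
    have h2 : 0 < 1 - κ := by
      by_contra h3
      push Not at h3
      nlinarith
    have := mul_le_mul_of_nonneg_left htn h2.le
    rw [hc]
    linarith
  have hpole : ∀ x, (doublePoleNumerator β μ c).eval x ≤ 0 ↔ 0 ≤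
      (C (1 - κ) * simplePoleNumerator (fun k => (mult k : ℝ)) lam ^ 2 -
        ∑ k, C (mult k : ℝ) * Lagrange.nodal (Finset.univ.erase k) lam ^ 2).eval x := by
    intro x
    rw [hfact', eval_mul, eval_C, neg_mul, Left.nonneg_neg_iff]
    exact ⟨fun h => mul_nonpos_of_nonneg_of_nonpos hn0.le h, fun h => by
      by_contra h'
      push Not at h'
      exact absurd h (not_le.2 (mul_pos hn0 h'))⟩
  rw [hZ]
  constructor
  · intro hκ
    -- As `d ≥ 3`, index `1` is an inner one; this gives `0 < m` and `m < n`.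
    have hm1 : mult ⟨1, by omega⟩ = m := hm _ (by simp) (by simp; omega)
    have hm0 : (0 : ℝ) < m := by
      have := hmult ⟨1, by omega⟩
      rw [hm1] at this
      exact_mod_cast this
    have hma : 1 ≤ (1 - κ) * m := by
      rw [hfrac _ hm0] at hκ
      have h1 : 1 / (m : ℝ) ≤ 1 - κ := by linarith
      rwa [div_le_iff₀ hm0] at h1
    have hmn : (m : ℝ) < n := by
      have h1 : mult ⟨1, by omega⟩ < ∑ k, mult k :=
        Finset.single_lt_sum (i := (⟨1, by omega⟩ : Fin (e + 2))) (j := 0)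
          (by rw [Ne, Fin.ext_iff]; simp) (Finset.mem_univ _) (Finset.mem_univ _)
          (hmult 0) fun k _ _ => Nat.zero_le _
      rw [hm1, ← hn] at h1
      exact_mod_cast h1
    have hcp : 0 < c := by
      have h2 : 0 < 1 - κ := by
        by_contra h3
        push Not at h3
        nlinarith
      have := mul_lt_mul_of_pos_left hmn h2
      rw [hc]
      linarith
    refine doublePoleNumerator.numNonrealZeros_eq_zero hβ hμ hcp fun j hj => ?_
    set J : Fin (e + 2) := ⟨j + 1, by omega⟩ with hJ
    -- The test point of each inner gap is the zero of `p` inside it, where the value is `(a m - 1)`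
    -- times a nonnegative number.
    refine ⟨lam J, mem_gap_self hlam hint J, (hpole _).2 ?_⟩
    have hz : ∀ k ≠ J, (Lagrange.nodal (Finset.univ.erase k) lam).eval (lam J) = 0 := fun k hk =>
      Lagrange.eval_nodal_at_node (Finset.mem_erase.2 ⟨hk.symm, Finset.mem_univ _⟩)
    rw [simplePoleNumerator, eval_sub, eval_mul, eval_pow, eval_finsetSum, eval_finsetSum,
      Finset.sum_eq_single J (fun k _ hk => by rw [eval_mul, hz k hk, mul_zero])
        (fun h => absurd (Finset.mem_univ J) h),
      Finset.sum_eq_single J (fun k _ hk => by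
        rw [eval_mul, eval_pow, hz k hk, zero_pow two_ne_zero, mul_zero])
        (fun h => absurd (Finset.mem_univ J) h), hm J (by simp [hJ]) (by simp [hJ]; omega)]
    simp only [eval_mul, eval_C, eval_pow]
    set u := (Lagrange.nodal (Finset.univ.erase J) lam).eval (lam J)
    have h3 : (1 - κ) * ((m : ℝ) * u) ^ 2 - m * u ^ 2 = ((1 - κ) * m - 1) * (m * u ^ 2) := by ring
    rw [h3]
    exact mul_nonneg (by linarith) (by positivity)
  · intro _
    have hupper : 0 < c → (numNonrealZeros (doublePoleNumerator β μ c) : ℤ) ≤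
        2 * ((e + 2 : ℕ) : ℤ) - 4 := by
      intro hcp
      have := doublePoleNumerator.numNonrealZeros_le hβ hμ hcp
      omega
    refine ⟨fun hκ => ⟨by positivity, hupper ?_⟩, fun k hk hkd hκ1 hκ2 => ?_, fun hκ => ?_,
      fun hκ => ?_⟩
    · push_cast at hκ
      refine hcpos ((n : ℝ) - e) (by linarith) (by linarith) ?_
      convert hκ using 2 <;> ring
    · have hkR : (k : ℝ) ≤ e + 1 := by exact_mod_cast (by omega : k ≤ e + 1)
      have hk2 : (2 : ℝ) ≤ k := by exact_mod_cast hk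
      push_cast at hκ1 hκ2
      have hcp : 0 < c := by
        refine hcpos ((n : ℝ) - (e + 2) + k + 1) (by linarith) (by linarith) ?_
        convert hκ2 using 2
        ring
      refine ⟨?_, hupper hcp⟩
      have ht : (0 : ℝ) < n - (e + 2) + k := by linarith
      rw [hfrac _ ht] at hκ1
      set K : Finset ℕ := (Finset.Icc 1 e).filter fun j =>
        ∃ x ∈ gap μ j, (doublePoleNumerator β μ c).eval x ≤ 0 with hKdef
      have hle := doublePoleNumerator.le_numNonrealZeros hβ hμ hcp K fun j hj hx =>
        Finset.mem_filter.2 ⟨Finset.mem_Icc.2 ⟨by omega, by omega⟩, hx⟩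
      -- With `s = d - k` the lower bound on `κ` reads `a ≤ 1/(n - s)`. At most `d - k - 1` of the
      -- `d - 2` inner gaps then have real zeros, leaving at least `2(k - 1)` non-real ones.
      have hlt := card_gaps_lt (a := 1 - κ) (s := e + 2 - k) (K := K) hlam hint
        (fun i => by exact_mod_cast hmult i) hzero (by omega) (by omega)
        (by
          rw [← hnR, Nat.cast_sub (by omega)]
          push_cast
          rw [show (n : ℝ) - (e + 2 - k) = n - (e + 2) + k by ring]
          linarith)
        (fun j hj => by
          obtain ⟨h1, x, hx, hx0⟩ := Finset.mem_filter.1 hj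
          exact ⟨(Finset.mem_Icc.1 h1).1, (Finset.mem_Icc.1 h1).2, x, hx, (hpole x).1 hx0⟩)
      omega
    · have hc0 : c = 0 := by
        rw [hc, hκ]
        field_simp
        ring
      rw [doublePoleNumerator.numNonrealZeros_of_nonpos hβ hμ.injective hc0.le, hc0,
        doublePoleNumerator.natDegree_eq_of_eq_zero hβ, Fintype.card_fin]
      push_cast
      omega
    · have hc0 : c < 0 := by
        rw [hfrac _ hn0] at hκ
        have h1 : 1 - κ < 1 / n := by linarith
        rw [lt_div_iff₀ hn0] at h1
        rw [hc]
        linarith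
      rw [doublePoleNumerator.numNonrealZeros_of_nonpos hβ hμ.injective hc0.le,
        doublePoleNumerator.natDegree_eq_of_ne_zero hc0.ne, Fintype.card_fin]
      push_cast
      omega
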